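/- Let $n,m\ge 0$ be integers, let $\mathcal U\subset\mathbb R^m$ be nonempty and compact, and let $f:\mathbb R^n\times\mathcal U\to\mathbb R^n$ be Lipschitz. Let $\mathbb U$ be the set of measurable functions $\mathbf u:\mathbb R_{\ge 0}\to\mathcal U$, and for $x\in\mathbb R^n$, $\mathbf u\in\mathbb U$ let $\mathbf x_x^{\mathbf u}:\mathbb R_{\ge0}\to\mathbb R^n$ be the unique continuous function with $\mathbf x_x^{\mathbf u}(t)=x+\int_0^t f(\mathbf x_x^{\mathbf u}(s),\mathbf u(s))\,ds$ for all $t\ge 0$. Let $\alpha:\mathbb R_{\ge0}\to\mathbb R_{\ge0}$ be a locally Lipschitz class $\mathcal K$ function, i.e. locally Lipschitz, strictly increasing and with $\alpha(0)=0$. For $r\ge 0$ let $\beta_\alpha(r,\cdot):\mathbb R_{\ge0}\to\mathbb R_{\ge0}$ be the solution of $\dot y=-\alpha(y)$, $y(0)=r$. Let $h:\mathbb R^n\to\mathbb R_{\ge0}$ be continuous, and define $H_\alpha:\mathbb R^n\times\mathbb R_{\ge0}\times\mathbb R^n\to\mathbb R$ by $H_\alpha(x,r,\lambda)=\max_{u\in\mathcal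 U}\lambda\cdot f(x,u)+\alpha(r)$. The following are equivalent: 1. $h$ is a viscosity control barrier function with respect to $\alpha$: for every $x$ with $h(x)>0$ and every continuously differentiable $\varphi:\mathbb R^n\to\mathbb R$ such that $h-\varphi$ has a local maximum at $x$, one has $\max_{u\in\mathcal U}\nabla\varphi(x)\cdot f(x,u)\ge-\alpha(h(x))$. 2. $h$ is a viscosity solution of $-\min\{H_\alpha(x,h,\nabla h),0\}=0$ on $\mathbb R^n$: for every continuously differentiable $\varphi:\mathbb R^n\to\mathbb R$, one has $-\min\{H_\alpha(x_0,h(x_0),\nabla\varphi(x_0)),0\}\le 0$ at every local maximum point $x_0$ of $h-\varphi$, and $-\min\{H_\alpha(x_0,h(x_0),\nabla\varphi(x_0)),0\}\ge 0$ at every local minimum point $x_0$ of $h-\varphi$. 3. The control barrier value function $v:\mathbb R^n\times\mathbb R_{\ge0}\to\mathbb R_{\ge0}$ corresponding to $h$ and $\alpha$, defined implicitly by $$\beta_\alpha(v(x,T),T)=\sup_{\mathbf u\in\mathbb U}\min_{t\in[0,T]}\beta_\alpha\big(h(\mathbf x_x^{\mathbf u}(t)),T-t\big),$$ is time-invariant,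 i.e. $v(x,T)=h(x)$ for all $x\in\mathbb R^n$ and $T\ge0$. 4. $h$ provides the Barrier Guarantee with respect to $\alpha$: for each $\theta\in[0,1)$ and each $x\in\mathbb R^n$ with $h(x)>0$ there is a $\mathbf u\in\mathbb U$ such that $h(\mathbf x_x^{\mathbf u}(t))\ge\beta_\alpha(\theta h(x),t)$ for all $t\ge0$. -/

import Mathlib

open scoped NNReal Gradient

noncomputable section

namespace ViscosityCBF

/-- Class `𝒦` functions on `[0, ∞)`. -/
structure IsClassK (α : ℝ≥0 → ℝ≥0) : Prop where
  continuous : Continuous α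
  strictMono : StrictMono α
  map_zero : α 0 = 0

/-- `y`, restricted to `[0, ∞)`, solves `y' = -α(y)`, `y(0) = r`
(the derivative at `t = 0` is one-sided). -/
structure IsDecaySolution (α : ℝ≥0 → ℝ≥0) (r : ℝ≥0) (y : ℝ → ℝ≥0) : Prop where
  initial : y 0 = r
  deriv : ∀ t : ℝ, 0 ≤ t →
    HasDerivWithinAt (fun s : ℝ => (y s : ℝ)) (-(α (y t) : ℝ)) (Set.Ici 0) t

/-- `β_α(r, t)` for `t ≥ 0`: the value at time `t` of the solution of `y' = -α(y)`, `y(0) = r`.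
For `α` locally Lipschitz of class `𝒦` that solution exists and is unique on `[0, ∞)`. -/
def beta (α : ℝ≥0 → ℝ≥0) (r : ℝ≥0) (t : ℝ) : ℝ≥0 :=
  Classical.epsilon (fun y : ℝ → ℝ≥0 => IsDecaySolution α r y) t

section System

variable {n m : ℕ} {U : Set (EuclideanSpace ℝ (Fin m))}

/-- `ξ`, restricted to `[0, ∞)`, is the (Carathéodory) state trajectory of `ξ' = f(ξ, u)` from `x`
under the control signal `u`, of which only the values on `[0, ∞)` matter. -/
structure IsTrajectory (f : EuclideanSpace ℝ (Fin n) × U → EuclideanSpace ℝ (Fin n))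
    (u : ℝ → U) (x : EuclideanSpace ℝ (Fin n)) (ξ : ℝ → EuclideanSpace ℝ (Fin n)) : Prop where
  continuousOn : ContinuousOn ξ (Set.Ici 0)
  integral_eq : ∀ t : ℝ, 0 ≤ t → ξ t = x + ∫ s in (0 : ℝ)..t, f (ξ s, u s)

/-- `max_{u ∈ U} p · f(x, u)`; the supremum is attained for `U` compact nonempty, `f` continuous. -/
def maxRate (f : EuclideanSpace ℝ (Fin n) × U → EuclideanSpace ℝ (Fin n))
    (x p : EuclideanSpace ℝ (Fin n)) : ℝ :=
  ⨆ u : U, inner ℝ p (f (x, u))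

/-- The Hamiltonian `H_α(x, r, p) = max_{u ∈ U} p · f(x, u) + α(r)`. -/
def hamiltonian (f : EuclideanSpace ℝ (Fin n) × U → EuclideanSpace ℝ (Fin n)) (α : ℝ≥0 → ℝ≥0)
    (x : EuclideanSpace ℝ (Fin n)) (r : ℝ≥0) (p : EuclideanSpace ℝ (Fin n)) : ℝ :=
  maxRate f x p + α r

/-- `h` is a viscosity control barrier function with respect to `α`. -/
def IsViscosityCBF (f : EuclideanSpace ℝ (Fin n) × U → EuclideanSpace ℝ (Fin n))
    (α : ℝ≥0 → ℝ≥0) (h : EuclideanSpace ℝ (Fin n) → ℝ) : Prop :=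
  Continuous h ∧ ∀ x, 0 < h x → ∀ φ : EuclideanSpace ℝ (Fin n) → ℝ, ContDiff ℝ 1 φ →
    IsLocalMax (fun y => h y - φ y) x → maxRate f x (∇ φ x) ≥ -(α (h x).toNNReal : ℝ)

/-- Continuous viscosity sub-solutions `μ : ℝⁿ → [0, ∞)` of `F(z, μ, ∇μ) = 0`. -/
def IsViscositySubsolution
    (F : EuclideanSpace ℝ (Fin n) → ℝ≥0 → EuclideanSpace ℝ (Fin n) → ℝ)
    (μ : EuclideanSpace ℝ (Fin n) → ℝ≥0) : Prop :=
  Continuous μ ∧ ∀ φ : EuclideanSpace ℝ (Fin n) → ℝ, ContDiff ℝ 1 φ → ∀ z,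
    IsLocalMax (fun y => (μ y : ℝ) - φ y) z → F z (μ z) (∇ φ z) ≤ 0

/-- Continuous viscosity super-solutions `μ : ℝⁿ → [0, ∞)` of `F(z, μ, ∇μ) = 0`. -/
def IsViscositySupersolution
    (F : EuclideanSpace ℝ (Fin n) → ℝ≥0 → EuclideanSpace ℝ (Fin n) → ℝ)
    (μ : EuclideanSpace ℝ (Fin n) → ℝ≥0) : Prop :=
  Continuous μ ∧ ∀ φ : EuclideanSpace ℝ (Fin n) → ℝ, ContDiff ℝ 1 φ → ∀ z,
    IsLocalMin (fun y => (μ y : ℝ) - φ y) z → F z (μ z) (∇ φ z) ≥ 0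

/-- Continuous viscosity solutions `μ : ℝⁿ → [0, ∞)` of `F(z, μ, ∇μ) = 0`. -/
def IsViscositySolution
    (F : EuclideanSpace ℝ (Fin n) → ℝ≥0 → EuclideanSpace ℝ (Fin n) → ℝ)
    (μ : EuclideanSpace ℝ (Fin n) → ℝ≥0) : Prop :=
  IsViscositySubsolution F μ ∧ IsViscositySupersolution F μ

/-- `sup_u min_{t ∈ [0,T]} β_α(g(ξ(t)), T - t)`, over the measurable control signals `u`, with `ξ`
the trajectory from `x` under `u`. The set is bounded by `β_α(g(x), T)`. -/
def cbvfPayoff (f : EuclideanSpace ℝ (Fin n) × U → EuclideanSpace ℝ (Fin n)) (α : ℝ≥0 → ℝ≥0)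
    (g : EuclideanSpace ℝ (Fin n) → ℝ≥0) (x : EuclideanSpace ℝ (Fin n)) (T : ℝ≥0) : ℝ≥0 :=
  sSup {w : ℝ≥0 | ∃ (u : ℝ → U) (ξ : ℝ → EuclideanSpace ℝ (Fin n)),
    Measurable u ∧ IsTrajectory f u x ξ ∧
      w = ⨅ t : Set.Icc (0 : ℝ) (T : ℝ), beta α (g (ξ t)) ((T : ℝ) - t)}

/-- The control barrier value function of `g` and `α`: the number `v = v(x, T) ≥ 0` such that
`β_α(v, T) = sup_u min_{t ∈ [0,T]} β_α(g(ξ(t)), T - t)`. -/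
def cbvf (f : EuclideanSpace ℝ (Fin n) × U → EuclideanSpace ℝ (Fin n)) (α : ℝ≥0 → ℝ≥0)
    (g : EuclideanSpace ℝ (Fin n) → ℝ≥0) (x : EuclideanSpace ℝ (Fin n)) (T : ℝ≥0) : ℝ≥0 :=
  Classical.epsilon (fun v : ℝ≥0 => beta α v T = cbvfPayoff f α g x T)

/-- `B` provides the Barrier Guarantee with respect to `α`. -/
def ProvidesBarrierGuarantee
    (f : EuclideanSpace ℝ (Fin n) × U → EuclideanSpace ℝ (Fin n)) (α : ℝ≥0 → ℝ≥0)
    (B : EuclideanSpace ℝ (Fin n) → ℝ) : Prop :=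
  Continuous B ∧ ∀ θ : ℝ, 0 ≤ θ → θ < 1 → ∀ x, 0 < B x →
    ∃ (u : ℝ → U) (ξ : ℝ → EuclideanSpace ℝ (Fin n)), Measurable u ∧ IsTrajectory f u x ξ ∧
      ∀ t : ℝ, 0 ≤ t → B (ξ t) ≥ beta α (θ * B x).toNNReal t

end System

end ViscosityCBF

end

noncomputable section

namespace ViscosityCBF

open Set Filter Topology MeasureTheory

/-! ### The scalar decay equation `y' = -α(y)` -/

section Decay

/-! The cycle is 1 → 4 → 3 → 1, with 1 ↔ 2 on the side.

1 ↔ 2: `-min H 0` is never negative, so the supersolution half is automatic, and the subsolution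
half says `H ≥ 0` at local maxima of `h - φ`. Where `h > 0` this is the CBF inequality; where `h =
0`, the test function has a local minimum, so its gradient vanishes and `H = α 0 ≥ 0`.

4 → 3: the time `0` term bounds the payoff by `β(h x, T)`. The guarantee and the semigroup law bound
it below by `β(θ h x, T)`; then `θ → 1`, and `β(·, T)` is injective.

3 → 1: if the CBF inequality fails at `x` by `c > 0`, every short trajectory makes `φ`, hence `h`,
fall faster than `α (h x)` by a fixed margin, while 3 provides trajectories losing at most `T α (h
x) + T ^ 2` in time `T`.

1 → 4 is the main step. The sup-convolution `a z = max (h - q‖· - z‖²)` approximates `h` uniformly,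
and its maximiser is a point where the CBF inequality applies with an explicit quadratic test
function. This yields a feedback (`exists_feedback`) whose sampled Euler trajectories keep `a` above
`β` up to a small error (`exists_trajectory_ge_sub`). The slack `θ < 1` absorbs the error, so no
limit of trajectories is taken; windows of fixed length are then concatenated.

Monotonicity of `α` makes the decay flow a contraction, so errors only add up; the local Lipschitz
bound makes it injective. -/

theorem antitoneOn_sq_sub_of_antitone {F : ℝ → ℝ} (hF : Antitone F) {s : Set ℝ} (hs : Convex ℝ s)
    {y z : ℝ → ℝ} (hy : ∀ t ∈ s, HasDerivWithinAt y (F (y t)) s t)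
    (hz : ∀ t ∈ s, HasDerivWithinAt z (F (z t)) s t) :
    AntitoneOn (fun t => (y t - z t) ^ 2) s := by
  have hd : ∀ t ∈ s, HasDerivWithinAt (fun t => (y t - z t) ^ 2)
      (2 * (y t - z t) * (F (y t) - F (z t))) s t := by
    intro t ht
    have := ((hy t ht).fun_sub (hz t ht)).fun_pow 2
    simpa using this
  refine antitoneOn_of_hasDerivWithinAt_nonpos hs (fun t ht => (hd t ht).continuousWithinAt)
    (fun t ht => (hd t (interior_subset ht)).mono interior_subset) (fun t _ => ?_)
  rcases le_total (y t) (z t) with h | h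
  · nlinarith [hF h]
  · nlinarith [hF h]

/-- Source of both forward uniqueness and the 1-Lipschitz dependence of `beta` on its initial value;
monotonicity suffices, no Lipschitz bound enters. -/
theorem abs_sub_le_of_antitone {F : ℝ → ℝ} (hF : Antitone F) {s : Set ℝ} (hs : Convex ℝ s)
    {y z : ℝ → ℝ} (hy : ∀ t ∈ s, HasDerivWithinAt y (F (y t)) s t)
    (hz : ∀ t ∈ s, HasDerivWithinAt z (F (z t)) s t) {a b : ℝ} (ha : a ∈ s) (hb : b ∈ s)
    (hab : a ≤ b) : |y b - z b| ≤ |y a - z a| :=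
  sq_le_sq.1 (antitoneOn_sq_sub_of_antitone hF hs hy hz ha hb hab)

variable {α : ℝ≥0 → ℝ≥0}

/-- The right-hand side of `y' = -α(y)`, extended by `0` to the negative half-line. -/
def decayField (α : ℝ≥0 → ℝ≥0) (y : ℝ) : ℝ := -(α y.toNNReal : ℝ)

theorem antitone_decayField (hα : Monotone α) : Antitone (decayField α) := fun _ _ h =>
  neg_le_neg (NNReal.coe_le_coe.2 (hα (Real.toNNReal_mono h)))

theorem IsDecaySolution.hasDerivWithinAt {r : ℝ≥0} {y : ℝ → ℝ≥0} (hy : IsDecaySolution α r y)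
    {t : ℝ} (ht : t ∈ Ici (0 : ℝ)) :
    HasDerivWithinAt (fun s : ℝ => (y s : ℝ)) (decayField α (y t)) (Ici 0) t := by
  simpa [decayField] using hy.deriv t ht

theorem exists_lipschitz_of_le (hα' : LocallyLipschitz α) (r : ℝ≥0) :
    ∃ L : ℝ≥0, LipschitzOnWith L α (Icc 0 r) :=
  (hα'.locallyLipschitzOn).exists_lipschitzOnWith_of_compact isCompact_Icc

/-- Truncating the argument of `α` to `[0, r]` makes the field globally Lipschitz and bounded by `α
r`, so Picard–Lindelöf covers all of `[0, N]` at once. The solution never leaves `[0, r]`, so the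
truncation is inactive. -/
theorem exists_decay_Icc (hα : IsClassK α) (hα' : LocallyLipschitz α) (r : ℝ≥0) (N : ℝ)
    (hN : 0 ≤ N) : ∃ y : ℝ → ℝ, y 0 = r ∧ (∀ t ∈ Icc 0 N, 0 ≤ y t) ∧
      ∀ t ∈ Icc 0 N, HasDerivWithinAt y (decayField α (y t)) (Icc 0 N) t := by
  obtain ⟨L, hL⟩ := exists_lipschitz_of_le hα' r
  let G : ℝ → ℝ := fun y => -(α (min y.toNNReal r) : ℝ)
  have hG : LipschitzWith L G := by
    refine LipschitzWith.of_dist_le_mul fun a b => ?_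
    have h1 := hL.dist_le_mul (min a.toNNReal r) ⟨zero_le, min_le_right _ _⟩
      (min b.toNNReal r) ⟨zero_le, min_le_right _ _⟩
    have h2 : dist (min a.toNNReal r) (min b.toNNReal r) ≤ dist a b := by
      simp only [NNReal.dist_eq, Real.dist_eq, NNReal.coe_min, Real.coe_toNNReal']
      refine (abs_min_sub_min_le_max _ _ _ _).trans ?_
      simp only [sub_self, abs_zero, abs_nonneg, sup_of_le_left]
      refine (abs_max_sub_max_le_max _ _ _ _).trans ?_
      simp
    calc dist (G a) (G b) = dist (α (min a.toNNReal r)) (α (min b.toNNReal r)) := by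
          simp only [G, NNReal.dist_eq, Real.dist_eq]
          rw [neg_sub_neg, abs_sub_comm]
      _ ≤ L * dist a b := h1.trans (by gcongr)
  have hPL : IsPicardLindelof (fun _ => G) (⟨0, le_rfl, hN⟩ : Icc (0 : ℝ) N) (r : ℝ)
      (α r * N.toNNReal) 0 (α r) L := by
    refine IsPicardLindelof.of_time_independent (fun x _ => ?_) hG.lipschitzOnWith ?_
    · simp only [G, norm_neg, NNReal.norm_eq]
      exact_mod_cast hα.strictMono.monotone (min_le_right _ _)
    · simp [hN]
  obtain ⟨y, hy0, hy⟩ := hPL.exists_eq_forall_mem_Icc_hasDerivWithinAt₀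
  have hy0 : y 0 = r := hy0
  have hanti : AntitoneOn y (Icc 0 N) := by
    refine antitoneOn_of_hasDerivWithinAt_nonpos (convex_Icc 0 N)
      (fun t ht => (hy t ht).continuousWithinAt)
      (fun t ht => (hy t (interior_subset ht)).mono interior_subset) (fun t _ => ?_)
    simp [G]
  have hle : ∀ t ∈ Icc 0 N, y t ≤ r := fun t ht => hy0 ▸ hanti ⟨le_rfl, hN⟩ ht ht.1
  have hnn : ∀ t ∈ Icc 0 N, 0 ≤ y t := by
    intro t ht
    by_contra! hlt
    have hsub : Icc 0 t ⊆ Icc 0 N := Icc_subset_Icc_right ht.2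
    -- After a zero `s` the decreasing `y` is nonpositive, where the field is `-α 0 = 0`; hence `y`
    -- cannot become negative.
    obtain ⟨s, hs, hys⟩ := intermediate_value_Icc' ht.1
      (fun a ha => ((hy a (hsub ha)).continuousWithinAt.mono hsub)) ⟨hlt.le, by simp [hy0]⟩
    have hsub' : Icc s t ⊆ Icc 0 N := Icc_subset_Icc hs.1 ht.2
    have hmono : MonotoneOn y (Icc s t) := by
      refine monotoneOn_of_hasDerivWithinAt_nonneg (convex_Icc s t)
        (fun a ha => (hy a (hsub' ha)).continuousWithinAt.mono hsub')
        (fun a ha => (hy a (hsub' (interior_subset ha))).mono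
          (interior_subset.trans hsub')) (fun a ha => ?_)
      have ha' := interior_subset ha
      have : y a ≤ 0 := hys ▸ hanti (hsub hs) (hsub' ha') ha'.1
      simp [G, Real.toNNReal_of_nonpos this, hα.map_zero]
    have := hmono ⟨le_rfl, hs.2⟩ ⟨hs.2, le_rfl⟩ hs.2
    linarith
  refine ⟨y, hy0, hnn, fun t ht => ?_⟩
  have : min (y t).toNNReal r = (y t).toNNReal :=
    min_eq_left (Real.toNNReal_le_iff_le_coe.2 (hle t ht))
  simpa [G, this, decayField] using hy t ht

theorem exists_isDecaySolution (hα : IsClassK α) (hα' : LocallyLipschitz α) (r : ℝ≥0) :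
    ∃ y, IsDecaySolution α r y := by
  choose! Y hY0 hYn hY using fun N : ℝ => exists_decay_Icc hα hα' r N
  have heq : ∀ M N : ℝ, 0 ≤ M → M ≤ N → ∀ t ∈ Icc 0 M, Y N t = Y M t := by
    intro M N hM hMN t ht
    have h := abs_sub_le_of_antitone (antitone_decayField hα.strictMono.monotone) (convex_Icc 0 M)
      (fun t ht => (hY N (hM.trans hMN) t (Icc_subset_Icc_right hMN ht)).mono
        (Icc_subset_Icc_right hMN)) (hY M hM) ⟨le_rfl, hM⟩ ht ht.1
    rw [hY0 M hM, hY0 N (hM.trans hMN), sub_self, abs_zero] at h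
    exact sub_eq_zero.1 (abs_nonpos_iff.1 h)
  have hYn' : ∀ t : ℝ, 0 ≤ t → ((Y t t).toNNReal : ℝ) = Y t t := fun t ht =>
    Real.coe_toNNReal _ (hYn t ht t ⟨ht, le_rfl⟩)
  -- Diagonal of the compatible family. The derivative at `t` is read off from `Y (t + 1)`, which
  -- leaves room to the right of `t`.
  refine ⟨fun t => (Y t t).toNNReal, by simp [hY0 0 le_rfl], fun t ht => ?_⟩
  have h1 : (0 : ℝ) ≤ t + 1 := by linarith
  have hd := hY (t + 1) h1 t ⟨ht, by linarith⟩
  rw [heq t (t + 1) ht (by linarith) t ⟨ht, le_rfl⟩] at hd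
  have hnhds : Icc 0 (t + 1) ∈ nhdsWithin t (Ici 0) := by
    rw [← Ici_inter_Iic]
    exact Filter.inter_mem self_mem_nhdsWithin
      (mem_nhdsWithin_of_mem_nhds (Iic_mem_nhds (by linarith)))
  have hd' := hd.mono_of_mem_nhdsWithin hnhds
  refine hd'.congr_of_eventuallyEq ?_ ?_
  · filter_upwards [hnhds] with s hs
    rw [hYn' s hs.1, heq s (t + 1) hs.1 hs.2 s ⟨hs.1, le_rfl⟩]
  · rw [hYn' t ht, heq t (t + 1) ht (by linarith) t ⟨ht, le_rfl⟩]

theorem isDecaySolution_beta (hα : IsClassK α) (hα' : LocallyLipschitz α) (r : ℝ≥0) :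
    IsDecaySolution α r (beta α r) :=
  Classical.epsilon_spec (exists_isDecaySolution hα hα' r)

theorem IsDecaySolution.eq_beta (hα : IsClassK α) (hα' : LocallyLipschitz α) {r : ℝ≥0}
    {y : ℝ → ℝ≥0} (hy : IsDecaySolution α r y) {t : ℝ} (ht : 0 ≤ t) : y t = beta α r t := by
  have hb := isDecaySolution_beta hα hα' r
  have h := abs_sub_le_of_antitone (antitone_decayField hα.strictMono.monotone) (convex_Ici 0)
    (fun t ht => hy.hasDerivWithinAt ht) (fun t ht => hb.hasDerivWithinAt ht) self_mem_Ici ht ht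
  rw [hy.initial, hb.initial, sub_self, abs_zero] at h
  exact NNReal.coe_injective (sub_eq_zero.1 (abs_nonpos_iff.1 h))

theorem beta_zero_time (hα : IsClassK α) (hα' : LocallyLipschitz α) (r : ℝ≥0) :
    beta α r 0 = r := (isDecaySolution_beta hα hα' r).initial

theorem beta_zero_left (hα : IsClassK α) (hα' : LocallyLipschitz α) {t : ℝ} (ht : 0 ≤ t) :
    beta α 0 t = 0 := by
  have : IsDecaySolution α 0 (fun _ => 0) :=
    ⟨rfl, fun t _ => by simpa [hα.map_zero] using hasDerivWithinAt_const t (Ici 0) (0 : ℝ)⟩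
  exact (this.eq_beta hα hα' ht).symm

theorem beta_beta (hα : IsClassK α) (hα' : LocallyLipschitz α) (r : ℝ≥0) {s t : ℝ}
    (hs : 0 ≤ s) (ht : 0 ≤ t) : beta α (beta α r s) t = beta α r (s + t) := by
  have hb := isDecaySolution_beta hα hα' r
  have : IsDecaySolution α (beta α r s) (fun t => beta α r (s + t)) := by
    refine ⟨by simp, fun t ht => ?_⟩
    have h1 := hb.deriv (s + t) (add_nonneg hs ht)
    have h2 : HasDerivWithinAt (fun t : ℝ => s + t) 1 (Ici 0) t :=
      (hasDerivWithinAt_id t _).const_add s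
    have := HasDerivWithinAt.scomp t h1 h2 (fun a ha => add_nonneg hs ha)
    simpa [Function.comp_def] using this
  exact (this.eq_beta hα hα' ht).symm

theorem antitoneOn_beta (hα : IsClassK α) (hα' : LocallyLipschitz α) (r : ℝ≥0) :
    AntitoneOn (beta α r) (Ici 0) := by
  have hb := isDecaySolution_beta hα hα' r
  have : AntitoneOn (fun t => (beta α r t : ℝ)) (Ici 0) := by
    refine antitoneOn_of_hasDerivWithinAt_nonpos (convex_Ici 0)
      (fun t ht => (hb.deriv t ht).continuousWithinAt)
      (fun t ht => (hb.deriv t (interior_subset ht)).mono interior_subset) (fun t _ => ?_)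
    simp
  exact fun a ha b hb' hab => NNReal.coe_le_coe.1 (this ha hb' hab)

theorem continuousOn_beta (hα : IsClassK α) (hα' : LocallyLipschitz α) (r : ℝ≥0) :
    ContinuousOn (fun t => (beta α r t : ℝ)) (Ici 0) := fun t ht =>
  ((isDecaySolution_beta hα hα' r).deriv t ht).continuousWithinAt

theorem beta_le (hα : IsClassK α) (hα' : LocallyLipschitz α) (r : ℝ≥0) {t : ℝ} (ht : 0 ≤ t) :
    beta α r t ≤ r := by
  simpa [beta_zero_time hα hα'] using antitoneOn_beta hα hα' r self_mem_Ici ht ht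

theorem abs_beta_sub_beta_le (hα : IsClassK α) (hα' : LocallyLipschitz α) (p q : ℝ≥0) {t : ℝ}
    (ht : 0 ≤ t) : |(beta α p t : ℝ) - beta α q t| ≤ |(p : ℝ) - q| := by
  have hp := isDecaySolution_beta hα hα' p
  have hq := isDecaySolution_beta hα hα' q
  have h := abs_sub_le_of_antitone (antitone_decayField hα.strictMono.monotone) (convex_Ici 0)
    (fun t ht => hp.hasDerivWithinAt ht) (fun t ht => hq.hasDerivWithinAt ht) self_mem_Ici ht ht
  rwa [hp.initial, hq.initial] at h

theorem continuous_beta_left (hα : IsClassK α) (hα' : LocallyLipschitz α) {t : ℝ} (ht : 0 ≤ t) :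
    Continuous (fun r => beta α r t) :=
  (LipschitzWith.of_dist_le_mul (K := 1) fun p q => by
    simpa [NNReal.dist_eq] using abs_beta_sub_beta_le hα hα' p q ht).continuous

/-- Backward uniqueness: with a Lipschitz constant `L` of `α` on `[0, max p q]`, the squared gap
shrinks at rate at most `2L`, so its product with `exp (2Lt)` is nondecreasing. -/
theorem injective_beta_left (hα : IsClassK α) (hα' : LocallyLipschitz α) {t : ℝ} (ht : 0 ≤ t) :
    Function.Injective (fun r => beta α r t) := by
  intro p q hpq
  obtain ⟨L, hL⟩ := exists_lipschitz_of_le hα' (max p q)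
  have hp := isDecaySolution_beta hα hα' p
  have hq := isDecaySolution_beta hα hα' q
  have hd : ∀ s ∈ Ici (0 : ℝ), HasDerivWithinAt
      (fun s => ((beta α p s : ℝ) - beta α q s) ^ 2 * Real.exp (2 * L * s))
      ((2 * ((beta α p s : ℝ) - beta α q s) * (-(α (beta α p s)) - -(α (beta α q s)))) *
        Real.exp (2 * L * s) +
        ((beta α p s : ℝ) - beta α q s) ^ 2 * (Real.exp (2 * L * s) * (2 * L))) (Ici 0) s := by
    intro s hs
    have h1 := ((hp.deriv s hs).fun_sub (hq.deriv s hs)).fun_pow 2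
    have h2 : HasDerivWithinAt (fun s : ℝ => Real.exp (2 * L * s))
        (Real.exp (2 * L * s) * (2 * L)) (Ici 0) s := by
      simpa using ((hasDerivWithinAt_id s (Ici 0)).const_mul (2 * (L : ℝ))).exp
    simpa using h1.fun_mul h2
  have hmono : MonotoneOn
      (fun s => ((beta α p s : ℝ) - beta α q s) ^ 2 * Real.exp (2 * L * s)) (Ici 0) := by
    refine monotoneOn_of_hasDerivWithinAt_nonneg (convex_Ici 0)
      (fun s hs => (hd s hs).continuousWithinAt)
      (fun s hs => (hd s (interior_subset hs)).mono interior_subset) (fun s hs => ?_)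
    have hs := interior_subset hs
    have h1 := hL.dist_le_mul (beta α p s)
      ⟨zero_le, (beta_le hα hα' p hs).trans (le_max_left _ _)⟩ (beta α q s)
      ⟨zero_le, (beta_le hα hα' q hs).trans (le_max_right _ _)⟩
    rw [NNReal.dist_eq, NNReal.dist_eq] at h1
    have h2 : ((beta α p s : ℝ) - beta α q s) * ((α (beta α p s) : ℝ) - α (beta α q s)) ≤
        L * ((beta α p s : ℝ) - beta α q s) ^ 2 := by
      calc _ ≤ |((beta α p s : ℝ) - beta α q s)| * |((α (beta α p s) : ℝ) - α (beta α q s))| := by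
            rw [← abs_mul]; exact le_abs_self _
        _ ≤ |((beta α p s : ℝ) - beta α q s)| * (L * |((beta α p s : ℝ) - beta α q s)|) := by
            gcongr
        _ = _ := by rw [← sq_abs ((beta α p s : ℝ) - beta α q s)]; ring
    have h3 := Real.exp_pos (2 * L * s)
    nlinarith
  have h := hmono self_mem_Ici ht ht
  simp only [hp.initial, hq.initial, mul_zero, Real.exp_zero, mul_one] at h
  simp only at hpq
  rw [hpq] at h
  simp only [sub_self, ne_eq, OfNat.ofNat_ne_zero, not_false_eq_true, zero_pow, zero_mul] at h
  exact NNReal.coe_injective (sub_eq_zero.1 (pow_eq_zero_iff (two_ne_zero)|>.1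
    (le_antisymm h (sq_nonneg _))))

theorem strictMono_beta_left (hα : IsClassK α) (hα' : LocallyLipschitz α) {t : ℝ} (ht : 0 ≤ t) :
    StrictMono (fun r => beta α r t) := by
  refine ((continuous_beta_left hα hα' ht).strictMono_of_inj
    (injective_beta_left hα hα' ht)).resolve_right fun h => ?_
  have := h (zero_lt_one)
  simp only [beta_zero_left hα hα' ht] at this
  exact absurd this not_lt_zero

/-- The contraction property in the additive form in which Euler errors are carried from one step to
the next. -/
theorem beta_le_beta_add (hα : IsClassK α) (hα' : LocallyLipschitz α) {p q : ℝ≥0} {c : ℝ}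
    (hc : 0 ≤ c) (h : (p : ℝ) ≤ q + c) {t : ℝ} (ht : 0 ≤ t) :
    (beta α p t : ℝ) ≤ beta α q t + c := by
  rcases le_total p q with hpq | hpq
  · have : (beta α p t : ℝ) ≤ beta α q t :=
      NNReal.coe_le_coe.2 ((strictMono_beta_left hα hα' ht).monotone hpq)
    linarith
  · have h1 := abs_beta_sub_beta_le hα hα' p q ht
    rw [abs_of_nonneg (sub_nonneg.2 (NNReal.coe_le_coe.2 hpq))] at h1
    linarith [le_abs_self ((beta α p t : ℝ) - beta α q t)]

/-- Along a decreasing solution `α` lies between its endpoint values: the explicit Euler step is a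
lower bound, the implicit one an upper bound. -/
theorem beta_bounds (hα : IsClassK α) (hα' : LocallyLipschitz α) (r : ℝ≥0) {t : ℝ}
    (ht : 0 ≤ t) : (r : ℝ) - t * α r ≤ beta α r t ∧
      (beta α r t : ℝ) ≤ r - t * α (beta α r t) := by
  have hb := isDecaySolution_beta hα hα' r
  have hsub : Icc 0 t ⊆ Ici 0 := Icc_subset_Ici_self
  have hm := hα.strictMono.monotone
  have hd : ∀ c : ℝ, ∀ s ∈ Icc 0 t, HasDerivWithinAt (fun s => (beta α r s : ℝ) + s * c)
      (-(α (beta α r s) : ℝ) + c) (Icc 0 t) s := fun c s hs => by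
    simpa using ((hb.deriv s (hsub hs)).mono hsub).fun_add ((hasDerivWithinAt_id s _).mul_const c)
  constructor
  · have hmono : MonotoneOn (fun s => (beta α r s : ℝ) + s * α r) (Icc 0 t) := by
      refine monotoneOn_of_hasDerivWithinAt_nonneg (convex_Icc 0 t)
        (fun s hs => (hd _ s hs).continuousWithinAt)
        (fun s hs => (hd _ s (interior_subset hs)).mono interior_subset) (fun s hs => ?_)
      have : (α (beta α r s) : ℝ) ≤ α r :=
        NNReal.coe_le_coe.2 (hm (beta_le hα hα' r (hsub (interior_subset hs))))
      linarith
    have := hmono ⟨le_rfl, ht⟩ ⟨ht, le_rfl⟩ ht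
    simp only [hb.initial, zero_mul, add_zero] at this
    linarith
  · have hanti : AntitoneOn (fun s => (beta α r s : ℝ) + s * α (beta α r t)) (Icc 0 t) := by
      refine antitoneOn_of_hasDerivWithinAt_nonpos (convex_Icc 0 t)
        (fun s hs => (hd _ s hs).continuousWithinAt)
        (fun s hs => (hd _ s (interior_subset hs)).mono interior_subset) (fun s hs => ?_)
      have hs := interior_subset hs
      have : (α (beta α r t) : ℝ) ≤ α (beta α r s) :=
        NNReal.coe_le_coe.2 (hm (antitoneOn_beta hα hα' r (hsub hs) ht hs.2))
      linarith
    have := hanti ⟨le_rfl, ht⟩ ⟨ht, le_rfl⟩ ht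
    simp only [hb.initial, zero_mul, add_zero] at this
    linarith

end Decay

/-! ### Trajectories: integrability, bounds, local existence, concatenation -/

section Glue

/-- Concatenation of a sequence of functions, each used on a time slot of length `δ`. -/
def glue {X : Type*} (δ : ℝ) (F : ℕ → ℝ → X) (t : ℝ) : X := F ⌊t / δ⌋₊ (t - ⌊t / δ⌋₊ * δ)

theorem glue_apply {X : Type*} {δ : ℝ} (hδ : 0 < δ) (F : ℕ → ℝ → X) {k : ℕ} {t : ℝ}
    (h1 : k * δ ≤ t) (h2 : t < k * δ + δ) : glue δ F t = F k (t - k * δ) := by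
  have ht : 0 ≤ t := le_trans (by positivity) h1
  have : ⌊t / δ⌋₊ = k := by
    rw [Nat.floor_eq_iff (by positivity), le_div_iff₀ hδ, div_lt_iff₀ hδ]
    exact ⟨h1, by linarith⟩
  rw [glue, this]

theorem measurable_glue {X : Type*} [MeasurableSpace X] (δ : ℝ) {F : ℕ → ℝ → X}
    (hF : ∀ k, Measurable (F k)) : Measurable (glue δ F) := by
  have h1 : Measurable (fun p : ℕ × ℝ => F p.1 p.2) := measurable_from_prod_countable_right hF
  have h2 : Measurable (fun t : ℝ => ⌊t / δ⌋₊) :=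
    Nat.measurable_floor.comp (measurable_id.div_const δ)
  have h3 : Measurable (fun t : ℝ => t - (⌊t / δ⌋₊ : ℝ) * δ) :=
    measurable_id.sub (((measurable_from_nat (f := fun k : ℕ => (k : ℝ))).comp h2).mul_const δ)
  exact h1.comp (h2.prodMk h3)

variable {E : Type*} [NormedAddCommGroup E] [NormedSpace ℝ E]

theorem glue_intervalIntegral {δ : ℝ} (hδ : 0 < δ) {g : ℕ → ℝ → E}
    (hg : ∀ k, IntervalIntegrable (g k) volume 0 δ) (k : ℕ) {τ : ℝ} (hτ : τ ∈ Icc 0 δ) :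
    IntervalIntegrable (glue δ g) volume (k * δ) (k * δ + τ) ∧
      ∫ s in (k * δ)..(k * δ + τ), glue δ g s = ∫ s in (0 : ℝ)..τ, g k s := by
  have hle : (k : ℝ) * δ ≤ k * δ + τ := by linarith [hτ.1]
  -- Only the open slot: at the right endpoint `glue` may already have switched to the next piece.
  have heq : EqOn (fun s => g k (s - k * δ)) (glue δ g) (Ioo (k * δ) (k * δ + τ)) :=
    fun s hs => (glue_apply hδ g hs.1.le (by linarith [hs.2, hτ.2])).symm
  constructor
  · have h1 : IntervalIntegrable (g k) volume 0 τ := by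
      refine (hg k).mono_set ?_
      rw [uIcc_of_le hτ.1, uIcc_of_le hδ.le]
      exact Icc_subset_Icc_right hτ.2
    have h2 := h1.comp_sub_right (k * δ)
    rw [zero_add, add_comm] at h2
    refine h2.congr_uIoo ?_
    rwa [uIoo_of_le hle]
  · rw [← intervalIntegral.integral_congr_Ioo_of_le hle heq,
      intervalIntegral.integral_comp_sub_right]
    simp

theorem glue_eq_integral {δ : ℝ} (hδ : 0 < δ) {ξ g : ℕ → ℝ → E}
    (hg : ∀ k, IntervalIntegrable (g k) volume 0 δ)
    (hξ : ∀ k, ∀ t ∈ Icc 0 δ, ξ k t = ξ k 0 + ∫ s in (0 : ℝ)..t, g k s)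
    (hnext : ∀ k, ξ (k + 1) 0 = ξ k δ) {t : ℝ} (ht : 0 ≤ t) :
    IntervalIntegrable (glue δ g) volume 0 t ∧
      glue δ ξ t = ξ 0 0 + ∫ s in (0 : ℝ)..t, glue δ g s := by
  have key : ∀ k : ℕ, IntervalIntegrable (glue δ g) volume 0 (k * δ) ∧
      ξ k 0 = ξ 0 0 + ∫ s in (0 : ℝ)..(k * δ), glue δ g s := by
    intro k
    induction k with
    | zero => simp
    | succ k ih =>
      have h := glue_intervalIntegral hδ hg k (τ := δ) ⟨hδ.le, le_rfl⟩
      have hk : ((k + 1 : ℕ) : ℝ) * δ = k * δ + δ := by push_cast; ring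
      rw [hk]
      refine ⟨ih.1.trans h.1, ?_⟩
      rw [← intervalIntegral.integral_add_adjacent_intervals ih.1 h.1, h.2, ← add_assoc, ← ih.2,
        hnext k, hξ k δ ⟨hδ.le, le_rfl⟩]
  have hk1 : (⌊t / δ⌋₊ : ℝ) * δ ≤ t := by
    rw [← le_div_iff₀ hδ]; exact Nat.floor_le (by positivity)
  have hk2 : t < (⌊t / δ⌋₊ : ℝ) * δ + δ := by
    have := Nat.lt_floor_add_one (t / δ)
    rw [div_lt_iff₀ hδ] at this; linarith
  have hmem : t - (⌊t / δ⌋₊ : ℝ) * δ ∈ Icc 0 δ := ⟨by linarith, by linarith⟩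
  have h := glue_intervalIntegral hδ hg ⌊t / δ⌋₊ hmem
  rw [add_sub_cancel] at h
  have hK := key ⌊t / δ⌋₊
  refine ⟨hK.1.trans h.1, ?_⟩
  rw [← intervalIntegral.integral_add_adjacent_intervals hK.1 h.1, h.2, ← add_assoc, ← hK.2,
    glue, hξ _ _ hmem]

end Glue

section Trajectory

variable {n m : ℕ} {U : Set (EuclideanSpace ℝ (Fin m))}
  {f : EuclideanSpace ℝ (Fin n) × U → EuclideanSpace ℝ (Fin n)}

/-- `ξ`, restricted to `[0, T]`, is a trajectory of `ξ' = f(ξ, u)`. -/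
structure IsTrajectoryOn (f : EuclideanSpace ℝ (Fin n) × U → EuclideanSpace ℝ (Fin n))
    (u : ℝ → U) (T : ℝ) (ξ : ℝ → EuclideanSpace ℝ (Fin n)) : Prop where
  continuousOn : ContinuousOn ξ (Icc 0 T)
  integral_eq : ∀ t ∈ Icc 0 T, ξ t = ξ 0 + ∫ s in (0 : ℝ)..t, f (ξ s, u s)

theorem IsTrajectory.apply_zero {u : ℝ → U} {x : EuclideanSpace ℝ (Fin n)}
    {ξ : ℝ → EuclideanSpace ℝ (Fin n)} (h : IsTrajectory f u x ξ) : ξ 0 = x := by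
  simpa using h.integral_eq 0 le_rfl

theorem IsTrajectory.isTrajectoryOn {u : ℝ → U} {x : EuclideanSpace ℝ (Fin n)}
    {ξ : ℝ → EuclideanSpace ℝ (Fin n)} (h : IsTrajectory f u x ξ) (T : ℝ) :
    IsTrajectoryOn f u T ξ :=
  ⟨h.continuousOn.mono Icc_subset_Ici_self, fun t ht => by
    rw [h.apply_zero]; exact h.integral_eq t ht.1⟩

theorem intervalIntegrable_dynamics (hU : IsCompact U) (hf : Continuous f) {u : ℝ → U}
    (hu : Measurable u) {T : ℝ} (hT : 0 ≤ T) {ξ : ℝ → EuclideanSpace ℝ (Fin n)}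
    (hξ : ContinuousOn ξ (Icc 0 T)) :
    IntervalIntegrable (fun s => f (ξ s, u s)) volume 0 T := by
  have : CompactSpace U := isCompact_iff_compactSpace.1 hU
  obtain ⟨C, hC⟩ := (((isCompact_Icc.image_of_continuousOn hξ).prod
    (isCompact_univ (X := U))).image hf).isBounded.exists_norm_le
  have hint : IntegrableOn (fun s => f (ξ s, u s)) (Icc 0 T) := by
    refine Integrable.of_bound ?_ C ?_
    · exact (hf.measurable.comp_aemeasurable
        ((hξ.aemeasurable measurableSet_Icc).prodMk hu.aemeasurable)).aestronglyMeasurable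
    · exact (ae_restrict_iff' measurableSet_Icc).2 (ae_of_all _ fun s hs =>
        hC _ ⟨(ξ s, u s), ⟨⟨s, hs, rfl⟩, mem_univ _⟩, rfl⟩)
  exact (intervalIntegrable_iff_integrableOn_Icc_of_le hT).2 hint

theorem isTrajectory_glue (hU : IsCompact U) (hf : Continuous f) {δ : ℝ} (hδ : 0 < δ)
    {u : ℕ → ℝ → U} (hu : ∀ k, Measurable (u k)) {ξ : ℕ → ℝ → EuclideanSpace ℝ (Fin n)}
    (hξ : ∀ k, IsTrajectoryOn f (u k) δ (ξ k)) (hnext : ∀ k, ξ (k + 1) 0 = ξ k δ) :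
    IsTrajectory f (glue δ u) (ξ 0 0) (glue δ ξ) := by
  have key := fun t (ht : (0 : ℝ) ≤ t) => glue_eq_integral hδ (ξ := ξ)
    (g := fun k s => f (ξ k s, u k s))
    (fun k => intervalIntegrable_dynamics hU hf (hu k) hδ.le (hξ k).continuousOn)
    (fun k => (hξ k).integral_eq) hnext ht
  refine ⟨fun t ht => ?_, fun t ht => (key t ht).2⟩
  have ht : 0 ≤ t := ht
  have ht1 : (0 : ℝ) ≤ t + 1 := by linarith
  -- Continuity across the seams comes from the integral formula, the primitive being continuous.
  have hc : ContinuousOn (fun b => ξ 0 0 + ∫ s in (0 : ℝ)..b,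
      glue δ (fun k s => f (ξ k s, u k s)) s) (Icc 0 (t + 1)) := by
    have := intervalIntegral.continuousOn_primitive_interval' (key (t + 1) ht1).1 left_mem_uIcc
    rw [uIcc_of_le ht1] at this
    exact continuousOn_const.add this
  have hc' : ContinuousOn (glue δ ξ) (Icc 0 (t + 1)) := hc.congr fun s hs => (key s hs.1).2
  refine (hc' t ⟨ht, by linarith⟩).mono_of_mem_nhdsWithin ?_
  rw [← Ici_inter_Iic]
  exact Filter.inter_mem self_mem_nhdsWithin
    (mem_nhdsWithin_of_mem_nhds (Iic_mem_nhds (by linarith)))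

theorem dist_dynamics_le {K : ℝ≥0} (hf : LipschitzWith K f) (x y : EuclideanSpace ℝ (Fin n))
    (v : U) : ‖f (x, v) - f (y, v)‖ ≤ K * ‖x - y‖ := by
  have := hf.dist_le_mul (x, v) (y, v)
  rwa [dist_eq_norm, Prod.dist_eq, dist_self, max_eq_left dist_nonneg, dist_eq_norm] at this

/-- The maximal deviation `S` satisfies `S ≤ (M + K S) T`, and `K T ≤ 1/2` absorbs the `S` on the
right; this replaces Grönwall. -/
theorem IsTrajectoryOn.norm_sub_le {K : ℝ≥0} (hf : LipschitzWith K f) {u : ℝ → U} {T : ℝ}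
    (hT : 0 ≤ T) (hKT : K * T ≤ 1 / 2) {ξ : ℝ → EuclideanSpace ℝ (Fin n)}
    (hξ : IsTrajectoryOn f u T ξ) {M : ℝ} (hM : ∀ v, ‖f (ξ 0, v)‖ ≤ M) :
    ∀ t ∈ Icc 0 T, ‖ξ t - ξ 0‖ ≤ 2 * M * T := by
  obtain ⟨s, hs, hmax⟩ := isCompact_Icc.exists_isMaxOn (nonempty_Icc.2 hT)
    (f := fun t => ‖ξ t - ξ 0‖) ((hξ.continuousOn.sub continuousOn_const).norm)
  set S := ‖ξ s - ξ 0‖ with hS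
  have hM0 : 0 ≤ M := (norm_nonneg _).trans (hM (u 0))
  have hS0 : 0 ≤ S := norm_nonneg _
  have hbound : S ≤ (M + K * S) * T := by
    have h1 : ξ s - ξ 0 = ∫ τ in (0 : ℝ)..s, f (ξ τ, u τ) := by
      nth_rw 1 [hξ.integral_eq s hs]; simp
    have h2 : ‖∫ τ in (0 : ℝ)..s, f (ξ τ, u τ)‖ ≤ (M + K * S) * |s - 0| := by
      refine intervalIntegral.norm_integral_le_of_norm_le_const fun τ hτ => ?_
      rw [uIoc_of_le hs.1] at hτ
      have hτ' : τ ∈ Icc 0 T := ⟨hτ.1.le, hτ.2.trans hs.2⟩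
      have h3 := dist_dynamics_le hf (ξ τ) (ξ 0) (u τ)
      have h4 : ‖ξ τ - ξ 0‖ ≤ S := hmax hτ'
      calc ‖f (ξ τ, u τ)‖ ≤ ‖f (ξ 0, u τ)‖ + ‖f (ξ τ, u τ) - f (ξ 0, u τ)‖ := norm_le_insert' _ _
        _ ≤ M + K * S := add_le_add (hM _) (h3.trans (by gcongr))
    rw [sub_zero, abs_of_nonneg hs.1] at h2
    exact ((congrArg norm h1).le.trans h2).trans (mul_le_mul_of_nonneg_left hs.2 (by positivity))
  have hfin : S ≤ 2 * M * T := by nlinarith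
  exact fun t ht => (hmax ht : ‖ξ t - ξ 0‖ ≤ S).trans hfin

theorem IsTrajectoryOn.inner_sub_le (hU : IsCompact U) (hf : Continuous f) {u : ℝ → U}
    (hu : Measurable u) {T : ℝ} (hT : 0 ≤ T) {ξ : ℝ → EuclideanSpace ℝ (Fin n)}
    (hξ : IsTrajectoryOn f u T ξ) (p : EuclideanSpace ℝ (Fin n)) {c : ℝ}
    (hc : ∀ s ∈ Icc 0 T, inner ℝ p (f (ξ s, u s)) ≤ c) :
    inner ℝ p (ξ T - ξ 0) ≤ T * c := by
  have hint := intervalIntegrable_dynamics hU hf hu hT hξ.continuousOn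
  have h1 : ξ T - ξ 0 = ∫ τ in (0 : ℝ)..T, f (ξ τ, u τ) := by
    nth_rw 1 [hξ.integral_eq T ⟨hT, le_rfl⟩]; simp
  have h2 := (innerSL ℝ p).intervalIntegral_comp_comm hint
  simp only [innerSL_apply_apply] at h2
  rw [h1, ← h2]
  have hint' : IntervalIntegrable (fun s => inner ℝ p (f (ξ s, u s))) volume 0 T :=
    ⟨(innerSL ℝ p).integrable_comp hint.1, (innerSL ℝ p).integrable_comp hint.2⟩
  have := intervalIntegral.integral_mono_on hT hint' intervalIntegrable_const hc
  simpa using this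

theorem IsTrajectoryOn.le_inner_sub (hU : IsCompact U) (hf : Continuous f) {u : ℝ → U}
    (hu : Measurable u) {T : ℝ} (hT : 0 ≤ T) {ξ : ℝ → EuclideanSpace ℝ (Fin n)}
    (hξ : IsTrajectoryOn f u T ξ) (p : EuclideanSpace ℝ (Fin n)) {c : ℝ}
    (hc : ∀ s ∈ Icc 0 T, c ≤ inner ℝ p (f (ξ s, u s))) :
    T * c ≤ inner ℝ p (ξ T - ξ 0) := by
  have := hξ.inner_sub_le hU hf hu hT (-p) (c := -c) (fun s hs => by
    rw [inner_neg_left]; exact neg_le_neg (hc s hs))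
  rw [inner_neg_left] at this
  linarith

theorem exists_isTrajectoryOn_const {K : ℝ≥0} (hf : LipschitzWith K f) {δ : ℝ} (hδ : 0 ≤ δ)
    (hKδ : K * δ ≤ 1 / 2) (v : U) (z : EuclideanSpace ℝ (Fin n)) :
    ∃ ξ, ξ 0 = z ∧ IsTrajectoryOn f (fun _ => v) δ ξ := by
  have hLip : LipschitzWith K (fun y => f (y, v)) :=
    LipschitzWith.of_dist_le_mul fun y w => by
      simpa [dist_eq_norm] using dist_dynamics_le hf y w v
  -- Within radius `2‖f (z, v)‖δ` of `z` the speed at most doubles, because `K δ ≤ 1/2`.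
  have hPL : IsPicardLindelof (fun _ y => f (y, v)) (⟨0, le_rfl, hδ⟩ : Icc (0 : ℝ) δ) z
      (2 * ‖f (z, v)‖₊ * δ.toNNReal) 0 (2 * ‖f (z, v)‖₊) K := by
    refine IsPicardLindelof.of_time_independent (f := fun y => f (y, v)) (fun y hy => ?_)
      hLip.lipschitzOnWith ?_
    · have h1 := dist_dynamics_le hf y z v
      rw [mem_closedBall_iff_norm] at hy
      push_cast [Real.coe_toNNReal _ hδ] at hy ⊢
      have h2 : (K : ℝ) * ‖y - z‖ ≤ K * (2 * ‖f (z, v)‖ * δ) := by gcongr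
      have h3 := norm_le_insert' (f (y, v)) (f (z, v))
      nlinarith [norm_nonneg (f (z, v))]
    · simp [hδ]
  obtain ⟨ξ, h0, hξ⟩ := hPL.exists_eq_forall_mem_Icc_hasDerivWithinAt₀
  have h0 : ξ 0 = z := h0
  have hcont : ContinuousOn ξ (Icc 0 δ) := fun t ht => (hξ t ht).continuousWithinAt
  refine ⟨ξ, h0, hcont, fun t ht => ?_⟩
  have hsub : uIcc 0 t ⊆ Icc 0 δ := by
    rw [uIcc_of_le ht.1]; exact Icc_subset_Icc_right ht.2
  have := ODE.picard_eq_of_hasDerivAt (f := fun _ y => f (y, v)) (α := ξ) (t₀ := 0) (t := t)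
    (u := univ) (hLip.continuous.comp continuous_snd).continuousOn
    (fun s hs => (hξ s (hsub hs)).mono hsub) (fun _ _ => mem_univ _)
  rw [← this, ODE.picard_apply]

end Trajectory

/-! ### The equivalences that need no construction of controls -/

section Equivalences

variable {n m : ℕ} {U : Set (EuclideanSpace ℝ (Fin m))}
  {f : EuclideanSpace ℝ (Fin n) × U → EuclideanSpace ℝ (Fin n)}
  {α : ℝ≥0 → ℝ≥0} {h : EuclideanSpace ℝ (Fin n) → ℝ≥0}

theorem exists_dynamics_bound (hU : IsCompact U) (hf : Continuous f)
    (x : EuclideanSpace ℝ (Fin n)) : ∃ M : ℝ, 0 < M ∧ ∀ v : U, ‖f (x, v)‖ ≤ M := by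
  have : CompactSpace U := isCompact_iff_compactSpace.1 hU
  obtain ⟨C, hC0, hC⟩ :=
    (isCompact_range (hf.comp (Continuous.prodMk_right x))).isBounded.exists_pos_norm_le
  exact ⟨C, hC0, fun v => hC _ ⟨v, rfl⟩⟩

theorem inner_le_maxRate (hU : IsCompact U) (hf : Continuous f)
    (x p : EuclideanSpace ℝ (Fin n)) (v : U) : inner ℝ p (f (x, v)) ≤ maxRate f x p := by
  obtain ⟨M, -, hM⟩ := exists_dynamics_bound hU hf x
  refine le_ciSup (f := fun v : U => inner ℝ p (f (x, v))) ⟨‖p‖ * M, ?_⟩ v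
  rintro _ ⟨w, rfl⟩
  exact (real_inner_le_norm _ _).trans (by gcongr; exact hM w)

theorem maxRate_zero (f : EuclideanSpace ℝ (Fin n) × U → EuclideanSpace ℝ (Fin n))
    (x : EuclideanSpace ℝ (Fin n)) : maxRate f x 0 = 0 := by
  simp [maxRate]

theorem hamiltonian_nonneg_of_isViscosityCBF
    (H : IsViscosityCBF f α (fun x => (h x : ℝ))) {φ : EuclideanSpace ℝ (Fin n) → ℝ}
    (hφ : ContDiff ℝ 1 φ) {z : EuclideanSpace ℝ (Fin n)}
    (hz : IsLocalMax (fun y => (h y : ℝ) - φ y) z) : 0 ≤ hamiltonian f α z (h z) (∇ φ z) := by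
  rcases eq_or_lt_of_le (zero_le (a := h z)) with h0 | h0
  · have hmin : IsLocalMin φ z := by
      filter_upwards [hz] with y hy
      have : (h z : ℝ) = 0 := by simp [← h0]
      have := (h y).coe_nonneg
      linarith
    have hgrad : ∇ φ z = 0 := by simp [gradient, hmin.fderiv_eq_zero]
    simp [hamiltonian, hgrad, maxRate_zero]
  · have := H.2 z (NNReal.coe_pos.2 h0) φ hφ hz
    rw [Real.toNNReal_coe] at this
    simp only [hamiltonian]
    linarith

theorem isViscositySolution_of_isViscosityCBF (hh : Continuous h)
    (H : IsViscosityCBF f α (fun x => (h x : ℝ))) :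
    IsViscositySolution (fun x r p => -min (hamiltonian f α x r p) 0) h :=
  ⟨⟨hh, fun φ hφ z hz => by
    simp [min_eq_right (hamiltonian_nonneg_of_isViscosityCBF H hφ hz)]⟩,
    hh, fun φ hφ z hz => neg_nonneg.2 (min_le_right _ _)⟩

theorem isViscosityCBF_of_isViscositySolution (hh : Continuous h)
    (H : IsViscositySolution (fun x r p => -min (hamiltonian f α x r p) 0) h) :
    IsViscosityCBF f α (fun x => (h x : ℝ)) := by
  refine ⟨NNReal.continuous_coe.comp hh, fun x _ φ hφ hx => ?_⟩
  have h1 := H.1.2 φ hφ x hx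
  have h2 : 0 ≤ hamiltonian f α x (h x) (∇ φ x) := (le_min_iff.1 (neg_nonpos.1 h1)).1
  rw [Real.toNNReal_coe]
  simp only [hamiltonian] at h2
  linarith

/-! ### Barrier value function -/

theorem le_beta_of_mem_payoff {x : EuclideanSpace ℝ (Fin n)} {T w : ℝ≥0}
    (hw : ∃ (u : ℝ → U) (ξ : ℝ → EuclideanSpace ℝ (Fin n)),
      Measurable u ∧ IsTrajectory f u x ξ ∧
      w = ⨅ t : Set.Icc (0 : ℝ) (T : ℝ), beta α (h (ξ t)) ((T : ℝ) - t)) :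
    w ≤ beta α (h x) T := by
  obtain ⟨u, ξ, -, hξ, rfl⟩ := hw
  have := ciInf_le (OrderBot.bddBelow (range fun t : Icc (0 : ℝ) (T : ℝ) =>
    beta α (h (ξ t)) ((T : ℝ) - t))) ⟨0, le_rfl, T.coe_nonneg⟩
  simpa [hξ.apply_zero] using this

theorem cbvfPayoff_le (x : EuclideanSpace ℝ (Fin n)) (T : ℝ≥0) :
    cbvfPayoff f α h x T ≤ beta α (h x) T :=
  csSup_le' fun _ hw => le_beta_of_mem_payoff hw

/-- The implicit definition is meaningful: the payoff lies between `β(0, T) = 0` and `β(h x, T)`, so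
the intermediate value theorem gives a solution. -/
theorem beta_cbvf (hα : IsClassK α) (hα' : LocallyLipschitz α) (x : EuclideanSpace ℝ (Fin n))
    (T : ℝ≥0) : beta α (cbvf f α h x T) T = cbvfPayoff f α h x T := by
  refine Classical.epsilon_spec (p := fun v => beta α v T = cbvfPayoff f α h x T) ?_
  obtain ⟨v, -, hv⟩ := intermediate_value_Icc (zero_le (a := h x))
    (continuous_beta_left hα hα' T.coe_nonneg).continuousOn
    (show cbvfPayoff f α h x T ∈ Icc (beta α 0 T) (beta α (h x) T) from
      ⟨by rw [beta_zero_left hα hα' T.coe_nonneg]; exact zero_le, cbvfPayoff_le x T⟩)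
  exact ⟨v, hv⟩

theorem cbvf_eq_of_providesBarrierGuarantee (hα : IsClassK α) (hα' : LocallyLipschitz α)
    (H : ProvidesBarrierGuarantee f α (fun x => (h x : ℝ))) (T : ℝ≥0)
    (x : EuclideanSpace ℝ (Fin n)) : cbvf f α h x T = h x := by
  have hT : (0 : ℝ) ≤ T := T.coe_nonneg
  refine injective_beta_left hα hα' hT ?_
  simp only [beta_cbvf hα hα']
  refine le_antisymm (cbvfPayoff_le x T) ?_
  rcases eq_or_lt_of_le (zero_le (a := h x)) with h0 | h0
  · rw [← h0, beta_zero_left hα hα' hT]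
    exact zero_le
  have hbdd : BddAbove {w : ℝ≥0 | ∃ (u : ℝ → U) (ξ : ℝ → EuclideanSpace ℝ (Fin n)),
      Measurable u ∧ IsTrajectory f u x ξ ∧
      w = ⨅ t : Set.Icc (0 : ℝ) (T : ℝ), beta α (h (ξ t)) ((T : ℝ) - t)} :=
    ⟨_, fun w hw => le_beta_of_mem_payoff hw⟩
  have hne : Nonempty (Icc (0 : ℝ) (T : ℝ)) := ⟨⟨0, le_rfl, hT⟩⟩
  have hlt : ∀ θ : ℝ, θ ∈ Ico (0 : ℝ) 1 →
      beta α (θ * h x).toNNReal T ≤ cbvfPayoff f α h x T := by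
    intro θ hθ
    obtain ⟨u, ξ, hu, hξ, hb⟩ := H.2 θ hθ.1 hθ.2 x (NNReal.coe_pos.2 h0)
    refine le_trans (le_ciInf fun t => ?_) (le_csSup hbdd ⟨u, ξ, hu, hξ, rfl⟩)
    have h1 : beta α (θ * h x).toNNReal t ≤ h (ξ t) := by exact_mod_cast hb t t.2.1
    -- Flowing the guarantee at time `t` for the remaining `T - t` turns it into a bound independent
    -- of `t`.
    have h2 := (strictMono_beta_left hα hα' (sub_nonneg.2 t.2.2)).monotone h1
    simp only [beta_beta hα hα' _ t.2.1 (sub_nonneg.2 t.2.2), add_sub_cancel] at h2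
    exact h2
  have hcont : Continuous fun θ : ℝ => beta α (θ * h x).toNNReal T :=
    (continuous_beta_left hα hα' hT).comp
      (continuous_real_toNNReal.comp (continuous_id.mul continuous_const))
  have hlim : Tendsto (fun θ : ℝ => beta α (θ * h x).toNNReal T) (𝓝[<] 1)
      (𝓝 (beta α (h x) T)) := by
    have := (hcont.tendsto 1).mono_left (nhdsWithin_le_nhds (s := Iio 1))
    simpa using this
  refine le_of_tendsto hlim ?_
  filter_upwards [Ico_mem_nhdsLT (zero_lt_one (α := ℝ))] with θ hθ using hlt θ hθ

theorem eventually_mul_lt (a : ℝ) {c : ℝ} (hc : 0 < c) : ∀ᶠ t in 𝓝[>] (0 : ℝ), a * t < c := by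
  have : Tendsto (fun t : ℝ => a * t) (𝓝[>] 0) (𝓝 0) :=
    ((continuous_const.mul continuous_id).tendsto' 0 0 (by simp)).mono_left nhdsWithin_le_nhds
  exact this.eventually_lt_const hc

theorem exists_trajectory_of_cbvf_eq (hα : IsClassK α) (hα' : LocallyLipschitz α)
    (H : ∀ (T : ℝ≥0) (x : EuclideanSpace ℝ (Fin n)), cbvf f α h x T = h x)
    (x : EuclideanSpace ℝ (Fin n)) (hx : 0 < h x) {T ε : ℝ} (hT : 0 ≤ T) (hε : 0 < ε) :
    ∃ (u : ℝ → U) (ξ : ℝ → EuclideanSpace ℝ (Fin n)), Measurable u ∧ IsTrajectory f u x ξ ∧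
      (beta α (h x) T : ℝ) - ε < h (ξ T) := by
  lift T to ℝ≥0 using hT
  have heq : cbvfPayoff f α h x T = beta α (h x) T := by rw [← beta_cbvf hα hα', H]
  -- Needed because the threshold is truncated at `0`, which must still lie strictly below the
  -- payoff.
  have hpos : 0 < beta α (h x) T := by
    have := strictMono_beta_left hα hα' T.coe_nonneg hx
    simpa [beta_zero_left hα hα' T.coe_nonneg] using this
  have hlt : ((beta α (h x) T : ℝ) - ε).toNNReal < cbvfPayoff f α h x T := by
    rw [heq, ← NNReal.coe_lt_coe, Real.coe_toNNReal']
    exact max_lt (by linarith) (NNReal.coe_pos.2 hpos)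
  obtain ⟨w, ⟨u, ξ, hu, hξ, rfl⟩, hw⟩ := exists_lt_of_lt_csSup' hlt
  refine ⟨u, ξ, hu, hξ, ?_⟩
  have h1 := ciInf_le (OrderBot.bddBelow (range fun t : Icc (0 : ℝ) (T : ℝ) =>
    beta α (h (ξ t)) ((T : ℝ) - t))) ⟨T, T.coe_nonneg, le_rfl⟩
  simp only [sub_self, beta_zero_time hα hα'] at h1
  exact lt_of_le_of_lt (Real.le_coe_toNNReal _) (NNReal.coe_lt_coe.2 (hw.trans_le h1))

theorem isViscosityCBF_of_cbvf_eq (hU : IsCompact U) {K : ℝ≥0} (hf : LipschitzWith K f)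
    (hα : IsClassK α) (hα' : LocallyLipschitz α) (hh : Continuous h)
    (H : ∀ (T : ℝ≥0) (x : EuclideanSpace ℝ (Fin n)), cbvf f α h x T = h x) :
    IsViscosityCBF f α (fun x => (h x : ℝ)) := by
  refine ⟨NNReal.continuous_coe.comp hh, fun x hx φ hφ hmax => ?_⟩
  rw [Real.toNNReal_coe]
  by_contra! hlt
  set p := ∇ φ x with hp
  set c : ℝ := -(α (h x) : ℝ) - maxRate f x p with hc
  have hc0 : 0 < c := by linarith
  obtain ⟨M, hM0, hM⟩ := exists_dynamics_bound hU hf.continuous x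
  have hgrad : HasGradientAt φ p x := (hφ.differentiable one_ne_zero x).hasGradientAt
  -- The displacement is at most `2MT`, so the Taylor remainder is at most `cT/4`.
  have hε0 : 0 < c / (8 * M) := by positivity
  have hev := (hasGradientAt_iff_isLittleO.1 hgrad).def hε0
  obtain ⟨ρ, hρ, hball⟩ := Metric.eventually_nhds_iff.1 (hev.and hmax)
  -- Taylor remainder, variation of `f` along the path and the optimality loss `T * T` each cost at
  -- most `cT/4`, together less than the deficit `cT`.
  obtain ⟨T, hT0, hT1, hT2, hT3, hT4⟩ :=
    (eventually_mem_nhdsWithin.and ((eventually_mul_lt K (show (0 : ℝ) < 1 / 2 by norm_num)).and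
    ((eventually_mul_lt (2 * M) hρ).and
    ((eventually_mul_lt (‖p‖ * (K * (2 * M))) (show 0 < c / 4 by positivity)).and
      (eventually_mul_lt 1 (show 0 < c / 4 by positivity)))))).exists
  have hT0 : 0 < T := hT0
  obtain ⟨u, ξ, hu, hξ, hlow⟩ := exists_trajectory_of_cbvf_eq hα hα' H x (NNReal.coe_pos.1 hx)
    hT0.le (mul_pos hT0 hT0)
  have hb := (beta_bounds hα hα' (h x) hT0.le).1
  have hon := hξ.isTrajectoryOn T
  have hnear : ∀ t ∈ Icc 0 T, ‖ξ t - x‖ ≤ 2 * M * T := by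
    have := hon.norm_sub_le hf hT0.le hT1.le (M := M) (by rwa [hξ.apply_zero])
    rwa [hξ.apply_zero] at this
  have hrate : inner ℝ p (ξ T - x) ≤ T * (maxRate f x p + ‖p‖ * (K * (2 * M * T))) := by
    have := hon.inner_sub_le hU hf.continuous hu hT0.le p
      (c := maxRate f x p + ‖p‖ * (K * (2 * M * T))) (fun s hs => by
      have h1 := inner_le_maxRate hU hf.continuous x p (u s)
      have h2 : inner ℝ p (f (ξ s, u s) - f (x, u s)) ≤ ‖p‖ * (K * (2 * M * T)) := by
        refine (real_inner_le_norm _ _).trans ?_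
        gcongr
        refine (dist_dynamics_le hf _ _ _).trans ?_
        gcongr
        exact hnear s hs
      rw [inner_sub_right] at h2
      linarith)
    rwa [hξ.apply_zero] at this
  have hTn := hnear T ⟨hT0.le, le_rfl⟩
  obtain ⟨h1, h2⟩ := hball (y := ξ T) (by rw [dist_eq_norm]; linarith)
  simp only [Real.norm_eq_abs] at h1
  have h3 := (abs_le.1 h1).2
  have h4 : c / (8 * M) * ‖ξ T - x‖ ≤ c / 4 * T := by
    calc c / (8 * M) * ‖ξ T - x‖ ≤ c / (8 * M) * (2 * M * T) := by gcongr
      _ = c / 4 * T := by field_simp; ring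
  have h5 : T * (‖p‖ * (K * (2 * M * T))) ≤ T * (c / 4) :=
    mul_le_mul_of_nonneg_left (by linarith) hT0.le
  have h6 : T * T ≤ T * (c / 4) := mul_le_mul_of_nonneg_left (by linarith) hT0.le
  have h7 : T * maxRate f x p = T * (-(α (h x) : ℝ) - c) := by rw [hc]; ring
  have h8 : 0 < T * c := by positivity
  nlinarith

end Equivalences

/-! ### Construction of controls from the viscosity inequality -/

section Construction

variable {n m : ℕ} {U : Set (EuclideanSpace ℝ (Fin m))}
  {f : EuclideanSpace ℝ (Fin n) × U → EuclideanSpace ℝ (Fin n)}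
  {α : ℝ≥0 → ℝ≥0} {h : EuclideanSpace ℝ (Fin n) → ℝ≥0}

theorem hasGradientAt_mul_norm_sub_sq (q : ℝ) (z y : EuclideanSpace ℝ (Fin n)) :
    HasGradientAt (fun w => q * ‖w - z‖ ^ 2) ((2 * q) • (y - z)) y := by
  rw [hasGradientAt_iff_hasFDerivAt]
  have h1 : HasFDerivAt (fun w : EuclideanSpace ℝ (Fin n) => w - z)
      (ContinuousLinearMap.id ℝ _) y := (hasFDerivAt_id y).sub_const z
  have h2 := (h1.norm_sq).const_mul q
  refine h2.congr_fderiv (ContinuousLinearMap.ext fun w => ?_)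
  simp
  ring

theorem exists_control_of_isLocalMax (hU' : U.Nonempty)
    (H : IsViscosityCBF f α (fun x => (h x : ℝ))) {q : ℝ} {y z : EuclideanSpace ℝ (Fin n)}
    (hy : IsLocalMax (fun w => (h w : ℝ) - q * ‖w - z‖ ^ 2) y) {η : ℝ} (hη : 0 < η) :
    ∃ v : U, -(α (h y) : ℝ) - η ≤ inner ℝ ((2 * q) • (y - z)) (f (y, v)) := by
  have : Nonempty U := hU'.to_subtype
  have h1 := hamiltonian_nonneg_of_isViscosityCBF H (φ := fun w => q * ‖w - z‖ ^ 2)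
    (contDiff_const.mul ((contDiff_id.sub contDiff_const).norm_sq ℝ)) hy
  rw [(hasGradientAt_mul_norm_sub_sq q z y).gradient, hamiltonian] at h1
  obtain ⟨v, hv⟩ := exists_lt_of_lt_ciSup
    (show -(α (h y) : ℝ) - η < ⨆ v : U, inner ℝ ((2 * q) • (y - z)) (f (y, v)) by
      rw [← maxRate]; linarith)
  exact ⟨v, hv.le⟩

/-- Sup-convolution on a ball: `Y z` maximises `h - q‖· - z‖²`, and it is close to `z`. -/
theorem exists_penalized_maximizer (hh : Continuous h) (x : EuclideanSpace ℝ (Fin n)) (R : ℝ)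
    {η : ℝ} (hη : 0 < η) :
    ∃ q ρ : ℝ, 0 < q ∧ 0 < ρ ∧ ρ < 1 ∧
      (∀ y ∈ Metric.closedBall x (R + 1), ∀ w ∈ Metric.closedBall x (R + 1), ‖y - w‖ ≤ ρ →
        |(h y : ℝ) - h w| ≤ η) ∧
      ∀ z ∈ Metric.closedBall x R, ∃ y ∈ Metric.closedBall x (R + 1),
        (∀ w ∈ Metric.closedBall x (R + 1),
          (h w : ℝ) - q * ‖w - z‖ ^ 2 ≤ h y - q * ‖y - z‖ ^ 2) ∧
        IsLocalMax (fun w => (h w : ℝ) - q * ‖w - z‖ ^ 2) y ∧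
        ‖y - z‖ ≤ 1 ∧ q * ‖y - z‖ ^ 2 ≤ η ∧ (h y : ℝ) ≤ h z + η := by
  have hcomp : IsCompact (Metric.closedBall x (R + 1)) := isCompact_closedBall _ _
  have hcont : Continuous fun y => (h y : ℝ) := NNReal.continuous_coe.comp hh
  obtain ⟨ρ₀, hρ₀, huc⟩ := Metric.uniformContinuousOn_iff.1
    (hcomp.uniformContinuousOn_of_continuous hcont.continuousOn) η hη
  obtain ⟨Mh, hMh0, hMh⟩ := (hcomp.image hcont).isBounded.exists_pos_norm_le
  have hMh' : ∀ y ∈ Metric.closedBall x (R + 1), (h y : ℝ) ≤ Mh := fun y hy =>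
    (le_abs_self _).trans (hMh _ ⟨y, hy, rfl⟩)
  obtain ⟨ρ, hρ0, hρ⟩ := exists_between (lt_min hρ₀ (zero_lt_one (α := ℝ)))
  have hρ1 : ρ < 1 := hρ.trans_le (min_le_right _ _)
  have hosc : ∀ y ∈ Metric.closedBall x (R + 1), ∀ w ∈ Metric.closedBall x (R + 1),
      ‖y - w‖ ≤ ρ → |(h y : ℝ) - h w| ≤ η := fun y hy w hw hyw => by
    have := huc y hy w hw (by
      rw [dist_eq_norm]; exact hyw.trans_lt (hρ.trans_le (min_le_left _ _)))
    rw [Real.dist_eq] at this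
    exact this.le
  -- With this `q` the penalty beyond distance `ρ` exceeds every value of `h ≥ 0` on the ball, which
  -- forces the maximiser within `ρ` of `z`.
  refine ⟨Mh / ρ ^ 2, ρ, by positivity, hρ0, hρ1, hosc, fun z hz => ?_⟩
  set q := Mh / ρ ^ 2 with hq
  have hq0 : 0 < q := by positivity
  have hzB : z ∈ Metric.closedBall x (R + 1) := Metric.closedBall_subset_closedBall (by linarith) hz
  obtain ⟨y, hyB, hy⟩ := hcomp.exists_isMaxOn ⟨z, hzB⟩
    (f := fun w => (h w : ℝ) - q * ‖w - z‖ ^ 2) (by fun_prop)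
  have hyz : (h z : ℝ) ≤ h y - q * ‖y - z‖ ^ 2 := by simpa using hy hzB
  have hsmall : q * ‖y - z‖ ^ 2 ≤ q * ρ ^ 2 := by
    have : q * ρ ^ 2 = Mh := by rw [hq]; field_simp
    linarith [hMh' y hyB, (h z).coe_nonneg]
  have hyzρ : ‖y - z‖ ≤ ρ := le_of_sq_le_sq (le_of_mul_le_mul_left hsmall hq0) hρ0.le
  have hyo := (abs_le.1 (hosc y hyB z hzB hyzρ)).2
  have hqn : 0 ≤ q * ‖y - z‖ ^ 2 := by positivity
  refine ⟨y, hyB, fun w hw => hy hw, ?_, hyzρ.trans hρ1.le, by linarith, by linarith⟩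
  -- As `ρ < 1`, the maximiser is interior to the larger ball, so the constrained maximum is a
  -- genuine local one.
  have hnhds : Metric.closedBall x (R + 1) ∈ 𝓝 y := by
    refine mem_of_superset (Metric.isOpen_ball.mem_nhds (x := y) ?_) Metric.ball_subset_closedBall
    rw [Metric.mem_closedBall, dist_eq_norm] at hz
    rw [Metric.mem_ball, dist_eq_norm]
    linarith [norm_sub_le_norm_sub_add_norm_sub y z x]
  filter_upwards [hnhds] with w hw using hy hw

/-- Change of the penalised value over one time step with a constant control. -/
theorem penalized_step (hU : IsCompact U) {K : ℝ≥0} (hf : LipschitzWith K f)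
    {q η δ C b : ℝ} (hq : 0 < q) (hδ : 0 ≤ δ) (hC : 0 ≤ C) {y : EuclideanSpace ℝ (Fin n)} {v : U}
    {ζ : ℝ → EuclideanSpace ℝ (Fin n)} (hζ : IsTrajectoryOn f (fun _ => v) δ ζ)
    (hv : b ≤ inner ℝ ((2 * q) • (y - ζ 0)) (f (y, v)))
    (hy1 : ‖y - ζ 0‖ ≤ 1) (hyη : q * ‖y - ζ 0‖ ^ 2 ≤ η)
    (hnear : ∀ t ∈ Icc 0 δ, ‖ζ t - ζ 0‖ ≤ C * δ) :
    δ * (b - 2 * K * η - δ * (q * (2 * K * C + C ^ 2))) ≤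
      q * ‖y - ζ 0‖ ^ 2 - q * ‖y - ζ δ‖ ^ 2 := by
  set p := (2 * q) • (y - ζ 0) with hp
  have hpn : ‖p‖ = 2 * q * ‖y - ζ 0‖ := by
    rw [hp, norm_smul, Real.norm_of_nonneg (by positivity)]
  have hrate : δ * (b - 2 * K * η - 2 * q * K * (C * δ)) ≤ inner ℝ p (ζ δ - ζ 0) := by
    refine hζ.le_inner_sub hU hf.continuous measurable_const hδ p fun s hs => ?_
    have h1 := dist_dynamics_le hf y (ζ s) v
    have h2 : ‖y - ζ s‖ ≤ ‖y - ζ 0‖ + C * δ := by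
      have := norm_sub_le_norm_sub_add_norm_sub y (ζ 0) (ζ s)
      rw [norm_sub_rev (ζ 0)] at this
      linarith [hnear s hs]
    have h3 : inner ℝ p (f (y, v) - f (ζ s, v)) ≤ 2 * K * η + 2 * q * K * (C * δ) := by
      -- The gradient may be large, but times the offset it is twice the penalty `q‖y - ζ 0‖²`, at
      -- most `η`: this error stays small although `q` may be large.
      calc inner ℝ p (f (y, v) - f (ζ s, v)) ≤ ‖p‖ * (K * (‖y - ζ 0‖ + C * δ)) :=
            (real_inner_le_norm _ _).trans (by gcongr; exact h1.trans (by gcongr))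
        _ = 2 * K * (q * ‖y - ζ 0‖ ^ 2) + 2 * q * K * (C * δ) * ‖y - ζ 0‖ := by rw [hpn]; ring
        _ ≤ 2 * K * η + 2 * q * K * (C * δ) * 1 := by gcongr
        _ = _ := by ring
    rw [inner_sub_right] at h3
    linarith
  have hsq : ‖y - ζ δ‖ ^ 2 = ‖y - ζ 0‖ ^ 2 - 2 * inner ℝ (y - ζ 0) (ζ δ - ζ 0)
      + ‖ζ δ - ζ 0‖ ^ 2 := by
    rw [← norm_sub_sq_real]; congr 2; abel
  have hin : inner ℝ p (ζ δ - ζ 0) = 2 * q * inner ℝ (y - ζ 0) (ζ δ - ζ 0) := by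
    rw [hp, inner_smul_left]; simp
  have h4 : q * ‖ζ δ - ζ 0‖ ^ 2 ≤ q * (C * δ) ^ 2 := by
    gcongr; exact hnear δ ⟨hδ, le_rfl⟩
  rw [hsq]
  nlinarith

/-- An explicit Euler step of `y' = -α(y)` lies above the exact solution up to second order. -/
theorem beta_le_euler (hα : IsClassK α) (hα' : LocallyLipschitz α) {B L : ℝ≥0}
    (hL : LipschitzOnWith L α (Icc 0 B)) {r : ℝ≥0} (hr : r ≤ B) {t : ℝ} (ht : 0 ≤ t) :
    (beta α r t : ℝ) ≤ r - t * α r + t * (t * (L * α B)) := by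
  obtain ⟨h1, h2⟩ := beta_bounds hα hα' r ht
  have hb := beta_le hα hα' r ht
  have h3 := hL.dist_le_mul r ⟨zero_le, hr⟩ _ ⟨zero_le, hb.trans hr⟩
  rw [NNReal.dist_eq, NNReal.dist_eq, abs_of_nonneg (sub_nonneg.2 (NNReal.coe_le_coe.2 hb))] at h3
  have h4 : (α r : ℝ) ≤ α B := NNReal.coe_le_coe.2 (hα.strictMono.monotone hr)
  have h5 : (L : ℝ) * (r - beta α r t) ≤ L * (t * α B) := by
    gcongr
    have : t * (α r : ℝ) ≤ t * α B := by gcongr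
    linarith
  have h6 : (α r : ℝ) - α (beta α r t) ≤ L * (t * α B) := (le_abs_self _).trans (h3.trans h5)
  have h7 := mul_le_mul_of_nonneg_left h6 ht
  nlinarith

/-- A feedback `V` along which a uniform approximation `a` of `h` decays, up to an error, no faster
than the solution of `y' = -α(y)`. -/
theorem exists_feedback (hU : IsCompact U) (hU' : U.Nonempty) {K : ℝ≥0} (hf : LipschitzWith K f)
    (hα : IsClassK α) (hα' : LocallyLipschitz α) (hh : Continuous h)
    (H : IsViscosityCBF f α (fun x => (h x : ℝ))) (x : EuclideanSpace ℝ (Fin n)) {R : ℝ}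
    (hR : 0 ≤ R) :
    ∃ A : ℝ, 0 ≤ A ∧ ∀ η : ℝ, 0 < η → ∃ (δ₀ : ℝ) (a : EuclideanSpace ℝ (Fin n) → ℝ)
      (V : EuclideanSpace ℝ (Fin n) → U), 0 < δ₀ ∧
      (∀ z ∈ Metric.closedBall x R, (h z : ℝ) ≤ a z ∧ a z ≤ h z + η) ∧
      ∀ δ ζ, 0 ≤ δ → δ ≤ δ₀ → K * δ ≤ 1 / 2 → ζ 0 ∈ Metric.closedBall x R →
        IsTrajectoryOn f (fun _ => V (ζ 0)) δ ζ →
        (ζ δ ∈ Metric.closedBall x R →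
          (beta α (a (ζ 0)).toNNReal δ : ℝ) ≤ a (ζ δ) + δ * (A * η)) ∧
        ∀ t ∈ Icc 0 δ, (h (ζ 0) : ℝ) - η ≤ h (ζ t) := by
  have hcomp : IsCompact (Metric.closedBall x (R + 1)) := isCompact_closedBall _ _
  obtain ⟨B, hB⟩ := (hcomp.image hh).bddAbove
  have hB : ∀ y ∈ Metric.closedBall x (R + 1), h y ≤ B := fun y hy => hB ⟨y, hy, rfl⟩
  obtain ⟨L, hL⟩ := exists_lipschitz_of_le hα' B
  obtain ⟨M, hM0, hM⟩ := exists_dynamics_bound hU hf.continuous x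
  -- The constant must not depend on `η`. It collects `η` from the near-optimal control, `η` from
  -- second-order terms, `2Kη` from evaluating `f` at `Y z` instead of along the path, and `Lη` from
  -- replacing `h (Y z)` by `a z` inside `α`.
  refine ⟨2 + 2 * K + L, by positivity, fun η hη => ?_⟩
  obtain ⟨q, ρ, hq, hρ0, hρ1, hosc, hY⟩ := exists_penalized_maximizer hh x R hη
  choose! Y hYB hYmax hYloc hY1 hYη hYh using hY
  have hV : ∀ z ∈ Metric.closedBall x R, ∃ v : U,
      -(α (h (Y z)) : ℝ) - η ≤ inner ℝ ((2 * q) • (Y z - z)) (f (Y z, v)) :=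
    fun z hz => exists_control_of_isLocalMax hU' H (hYloc z hz) hη
  have : Nonempty U := hU'.to_subtype
  choose! V hV using hV
  set C : ℝ := 2 * (M + K * R) with hC
  have hC0 : 0 < C := by positivity
  set Q : ℝ := q * (2 * K * C + C ^ 2) + L * α B with hQ
  have hQ0 : 0 ≤ Q := by positivity
  set a : EuclideanSpace ℝ (Fin n) → ℝ := fun z => (h (Y z) : ℝ) - q * ‖Y z - z‖ ^ 2 with ha
  have hsub : Metric.closedBall x R ⊆ Metric.closedBall x (R + 1) :=
    Metric.closedBall_subset_closedBall (by linarith)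
  have ha1 : ∀ z ∈ Metric.closedBall x R, (h z : ℝ) ≤ a z := fun z hz => by
    simpa using hYmax z hz z (hsub hz)
  have ha2 : ∀ z, a z ≤ h (Y z) := fun z => by
    have : 0 ≤ q * ‖Y z - z‖ ^ 2 := by positivity
    simp only [ha]; linarith
  -- The first bound makes second-order terms at most `η` per unit time; the second keeps the motion
  -- within a step below `ρ`.
  refine ⟨min (η / (Q + 1)) (ρ / C), a, V, by positivity,
    fun z hz => ⟨ha1 z hz, (ha2 z).trans (hYh z hz)⟩, ?_⟩
  intro δ ζ hδ hδ₀ hKδ hz hζ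
  have hδQ : δ * Q ≤ η := by
    have h1 : δ * (Q + 1) ≤ η :=
      (le_div_iff₀ (by positivity)).1 (hδ₀.trans (min_le_left _ _))
    linarith
  have hδC : C * δ ≤ ρ := by
    have := (le_div_iff₀ hC0).1 (hδ₀.trans (min_le_right _ _))
    linarith
  have hnear : ∀ t ∈ Icc 0 δ, ‖ζ t - ζ 0‖ ≤ C * δ := by
    refine hζ.norm_sub_le hf hδ hKδ (M := M + K * R) fun v => ?_
    have h1 := dist_dynamics_le hf (ζ 0) x v
    have h2 := norm_le_insert' (f (ζ 0, v)) (f (x, v))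
    rw [mem_closedBall_iff_norm] at hz
    have h3 : (K : ℝ) * ‖ζ 0 - x‖ ≤ K * R := by gcongr
    linarith [hM v]
  refine ⟨fun hzδ => ?_, fun t ht => ?_⟩
  · have hstep := penalized_step hU hf hq hδ hC0.le hζ (hV _ hz) (hY1 _ hz) (hYη _ hz) hnear
    -- The old maximiser competes in the sup-convolution at the new point, which bounds `a (ζ δ)`
    -- from below.
    have hmax := hYmax (ζ δ) hzδ (Y (ζ 0)) (hYB _ hz)
    have ha0 : 0 ≤ a (ζ 0) := (h (ζ 0)).coe_nonneg.trans (ha1 _ hz)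
    have hcoe : ((a (ζ 0)).toNNReal : ℝ) = a (ζ 0) := Real.coe_toNNReal _ ha0
    have hle : (a (ζ 0)).toNNReal ≤ h (Y (ζ 0)) := Real.toNNReal_le_iff_le_coe.2 (ha2 _)
    have hYle := hB _ (hYB _ hz)
    have heul := beta_le_euler hα hα' hL (hle.trans hYle) hδ
    rw [hcoe] at heul
    have hlip := hL.dist_le_mul (h (Y (ζ 0))) ⟨zero_le, hYle⟩ (a (ζ 0)).toNNReal
      ⟨zero_le, hle.trans hYle⟩
    rw [NNReal.dist_eq, NNReal.dist_eq, hcoe] at hlip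
    have hdiff : |(h (Y (ζ 0)) : ℝ) - a (ζ 0)| ≤ η := by
      simp only [ha, sub_sub_cancel]
      rw [abs_of_nonneg (by positivity)]
      exact hYη _ hz
    have hlip' : (α (h (Y (ζ 0))) : ℝ) - α (a (ζ 0)).toNNReal ≤ L * η :=
      (le_abs_self _).trans (hlip.trans (by gcongr))
    have h1 := mul_le_mul_of_nonneg_left hlip' hδ
    have h2 := mul_le_mul_of_nonneg_left hδQ hδ
    simp only [ha] at heul h1 ⊢
    simp only [hQ] at h2
    nlinarith
  · have hnt := (hnear t ht).trans hδC
    have hzt : ζ t ∈ Metric.closedBall x (R + 1) := by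
      rw [mem_closedBall_iff_norm] at hz ⊢
      linarith [norm_sub_le_norm_sub_add_norm_sub (ζ t) (ζ 0) x]
    linarith [(abs_le.1 (hosc _ hzt _ (hsub hz) hnt)).1]

/-- Near-optimal trajectories on a short time interval. -/
theorem exists_trajectory_ge_sub (hU : IsCompact U) (hU' : U.Nonempty) {K : ℝ≥0}
    (hf : LipschitzWith K f) (hα : IsClassK α) (hα' : LocallyLipschitz α) (hh : Continuous h)
    (H : IsViscosityCBF f α (fun x => (h x : ℝ))) (x : EuclideanSpace ℝ (Fin n)) {T c : ℝ}
    (hT : 0 < T) (hKT : K * T ≤ 1 / 2) (hc : 0 < c) :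
    ∃ (u : ℝ → U) (ξ : ℝ → EuclideanSpace ℝ (Fin n)), Measurable u ∧ IsTrajectory f u x ξ ∧
      ∀ t ∈ Icc 0 T, (beta α (h x) t : ℝ) - c ≤ h (ξ t) := by
  obtain ⟨M, hM0, hM⟩ := exists_dynamics_bound hU hf.continuous x
  set R : ℝ := 2 * M * T with hR
  have hR0 : 0 ≤ R := by positivity
  obtain ⟨A, hA, hfb⟩ := exists_feedback hU hU' hf hα hα' hh H x hR0
  -- `T * A * η` is the drift accumulated over the steps; `2 * η` pays for `a` versus `h` at a grid
  -- point and for the motion of `h` within a step.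
  set η : ℝ := c / (T * A + 2) with hη
  have hη0 : 0 < η := by positivity
  have hηc : T * (A * η) + 2 * η = c := by rw [hη]; field_simp
  obtain ⟨δ₀, a, V, hδ₀, ha, hstep⟩ := hfb η hη0
  obtain ⟨N, hN⟩ := exists_nat_gt (T / δ₀)
  have hN0 : (0 : ℝ) < N := lt_trans (by positivity) hN
  set δ : ℝ := T / N with hδ
  have hδ0 : 0 < δ := by positivity
  have hNδ : (N : ℝ) * δ = T := by rw [hδ]; field_simp
  have hδδ₀ : δ ≤ δ₀ := by
    rw [hδ, div_le_iff₀ hN0]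
    rw [div_lt_iff₀ hδ₀] at hN
    linarith
  have hδT : δ ≤ T := by
    have : (1 : ℝ) ≤ N := by exact_mod_cast (Nat.cast_pos.1 hN0 : 0 < N)
    nlinarith
  have hKδ : (K : ℝ) * δ ≤ 1 / 2 := le_trans (by gcongr) hKT
  choose ζ hζ0 hζ using fun z => exists_isTrajectoryOn_const hf hδ0.le hKδ (V z) z
  obtain ⟨z, hz0, hzs⟩ : ∃ z : ℕ → EuclideanSpace ℝ (Fin n),
      z 0 = x ∧ ∀ k, z (k + 1) = ζ (z k) δ :=
    ⟨fun k => Nat.rec x (fun _ w => ζ w δ) k, rfl, fun _ => rfl⟩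
  have hmeas : Measurable (glue δ fun k (_ : ℝ) => V (z k)) :=
    measurable_glue δ fun k => measurable_const
  have htraj : IsTrajectory f (glue δ fun k _ => V (z k)) x (glue δ fun k => ζ (z k)) := by
    have := isTrajectory_glue hU hf.continuous hδ0 (u := fun k _ => V (z k))
      (fun k => measurable_const) (ξ := fun k => ζ (z k)) (fun k => hζ (z k))
      (fun k => by rw [hζ0, hzs])
    rwa [hζ0, hz0] at this
  refine ⟨_, _, hmeas, htraj, ?_⟩
  have hball : ∀ t ∈ Icc 0 T, (glue δ fun k => ζ (z k)) t ∈ Metric.closedBall x R := by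
    intro t ht
    have := (htraj.isTrajectoryOn T).norm_sub_le hf hT.le hKT (M := M)
      (by rwa [htraj.apply_zero]) t ht
    rw [htraj.apply_zero] at this
    rwa [mem_closedBall_iff_norm]
  have hzball : ∀ k ≤ N, z k ∈ Metric.closedBall x R := by
    intro k hk
    have hk' : (k : ℝ) * δ ≤ T := by
      rw [← hNδ]; gcongr
    have := hball (k * δ) ⟨by positivity, hk'⟩
    rwa [glue_apply hδ0 _ le_rfl (by linarith), sub_self, hζ0] at this
  have hinv : ∀ k ≤ N, (beta α (h x) (k * δ) : ℝ) ≤ a (z k) + k * δ * (A * η) := by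
    intro k
    induction k with
    | zero =>
      intro _
      simpa [beta_zero_time hα hα', hz0] using (ha x (Metric.mem_closedBall_self hR0)).1
    | succ k ih =>
      intro hk
      have hkb := hzball k (by omega)
      have h1 := ih (by omega)
      have h2 := (hstep δ (ζ (z k)) hδ0.le hδδ₀ hKδ (by rwa [hζ0]) (by rw [hζ0]; exact hζ _)).1
        (by rw [← hzs]; exact hzball _ hk)
      rw [hζ0, ← hzs] at h2
      -- Contraction carries the earlier error over unamplified.
      have h3 : (beta α (beta α (h x) (k * δ)) δ : ℝ) ≤
          beta α (a (z k)).toNNReal δ + k * δ * (A * η) :=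
        beta_le_beta_add hα hα' (by positivity)
          (h1.trans (add_le_add_left (Real.le_coe_toNNReal _) _)) hδ0.le
      rw [beta_beta hα hα' _ (by positivity) hδ0.le] at h3
      have h4 : ((k + 1 : ℕ) : ℝ) * δ = k * δ + δ := by push_cast; ring
      rw [h4]
      linarith
  intro t ht
  set k := ⌊t / δ⌋₊ with hk
  have hk1 : (k : ℝ) * δ ≤ t := by
    rw [← le_div_iff₀ hδ0]; exact Nat.floor_le (div_nonneg ht.1 hδ0.le)
  have hk2 : t < (k : ℝ) * δ + δ := by
    have := Nat.lt_floor_add_one (t / δ)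
    rw [div_lt_iff₀ hδ0] at this; linarith
  have hkN : k ≤ N := by
    have : (k : ℝ) * δ ≤ N * δ := by rw [hNδ]; exact hk1.trans ht.2
    exact_mod_cast le_of_mul_le_mul_right this hδ0
  have hkb := hzball k hkN
  rw [glue_apply hδ0 _ hk1 hk2]
  have h1 := (hstep δ (ζ (z k)) hδ0.le hδδ₀ hKδ (by rwa [hζ0]) (by rw [hζ0]; exact hζ _)).2
    (t - k * δ) ⟨by linarith, by linarith⟩
  rw [hζ0] at h1
  have h2 := hinv k hkN
  have h3 := (ha _ hkb).2
  have h4 : (beta α (h x) t : ℝ) ≤ beta α (h x) (k * δ) := NNReal.coe_le_coe.2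
    (antitoneOn_beta hα hα' _ (show (0 : ℝ) ≤ k * δ by positivity) ht.1 hk1)
  have h5 : (k : ℝ) * δ * (A * η) ≤ T * (A * η) := by
    gcongr; exact hk1.trans ht.2
  linarith

/-- The gap between the decay solutions from `h x` and `r` has a positive minimum on `[0, T]`; half
of it is the allowed error. The strict inequality persists at time `T`, so the construction can be
iterated. -/
theorem exists_trajectory_gt (hU : IsCompact U) (hU' : U.Nonempty) {K : ℝ≥0}
    (hf : LipschitzWith K f) (hα : IsClassK α) (hα' : LocallyLipschitz α) (hh : Continuous h)
    (H : IsViscosityCBF f α (fun x => (h x : ℝ))) {T : ℝ} (hT : 0 < T) (hKT : K * T ≤ 1 / 2)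
    (x : EuclideanSpace ℝ (Fin n)) (r : ℝ≥0) (hr : r < h x) :
    ∃ (u : ℝ → U) (ξ : ℝ → EuclideanSpace ℝ (Fin n)), Measurable u ∧ IsTrajectory f u x ξ ∧
      ∀ t ∈ Icc 0 T, beta α r t < h (ξ t) := by
  obtain ⟨s, hs, hmin⟩ := isCompact_Icc.exists_isMinOn (nonempty_Icc.2 hT.le)
    (f := fun t => (beta α (h x) t : ℝ) - beta α r t)
    (((continuousOn_beta hα hα' (h x)).sub (continuousOn_beta hα hα' r)).mono Icc_subset_Ici_self)
  have hpos : 0 < (beta α (h x) s : ℝ) - beta α r s :=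
    sub_pos.2 (NNReal.coe_lt_coe.2 (strictMono_beta_left hα hα' hs.1 hr))
  obtain ⟨u, ξ, hu, hξ, hb⟩ := exists_trajectory_ge_sub hU hU' hf hα hα' hh H x hT hKT
    (half_pos hpos)
  refine ⟨u, ξ, hu, hξ, fun t ht => NNReal.coe_lt_coe.1 ?_⟩
  have h1 := hb t ht
  have h2 : (beta α (h x) s : ℝ) - beta α r s ≤ beta α (h x) t - beta α r t := hmin ht
  linarith

theorem providesBarrierGuarantee_of_isViscosityCBF (hU : IsCompact U) (hU' : U.Nonempty)
    {K : ℝ≥0} (hf : LipschitzWith K f) (hα : IsClassK α) (hα' : LocallyLipschitz α)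
    (hh : Continuous h) (H : IsViscosityCBF f α (fun x => (h x : ℝ))) :
    ProvidesBarrierGuarantee f α (fun x => (h x : ℝ)) := by
  refine ⟨H.1, fun θ hθ0 hθ1 x hx => ?_⟩
  have hx : (0 : ℝ) < h x := hx
  set r := (θ * (h x : ℝ)).toNNReal with hr
  have hrx : r < h x := by
    rw [← NNReal.coe_lt_coe, hr, Real.coe_toNNReal _ (by positivity)]
    nlinarith
  -- The window depends only on `K`, so finitely many windows reach any time; the `+ 2` covers `K =
  -- 0`.
  set T : ℝ := 1 / (2 * K + 2) with hT
  have hT0 : 0 < T := by positivity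
  have hKT : (K : ℝ) * T ≤ 1 / 2 := by
    rw [hT, mul_one_div, div_le_div_iff₀ (by positivity) (by norm_num)]
    linarith
  have : Nonempty U := hU'.to_subtype
  -- Each window restarts from the current state and the current level of `β`.
  choose! u ξ hu hξ hb using exists_trajectory_gt hU hU' hf hα hα' hh H hT0 hKT
  obtain ⟨z, hz0, hzs⟩ : ∃ z : ℕ → EuclideanSpace ℝ (Fin n),
      z 0 = x ∧ ∀ k : ℕ, z (k + 1) = ξ (z k) (beta α r (k * T)) T :=
    ⟨fun k => Nat.rec x (fun k w => ξ w (beta α r (k * T)) T) k, rfl, fun _ => rfl⟩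
  have hinv : ∀ k : ℕ, beta α r (k * T) < h (z k) := by
    intro k
    induction k with
    | zero => simpa [beta_zero_time hα hα', hz0] using hrx
    | succ k ih =>
      have := hb _ _ ih T ⟨hT0.le, le_rfl⟩
      rw [beta_beta hα hα' _ (by positivity) hT0.le, ← hzs] at this
      have h4 : ((k + 1 : ℕ) : ℝ) * T = k * T + T := by push_cast; ring
      rwa [h4]
  have htraj := isTrajectory_glue hU hf.continuous hT0
    (u := fun k => u (z k) (beta α r (k * T))) (fun k => hu _ _ (hinv k))
    (ξ := fun k => ξ (z k) (beta α r (k * T))) (fun k => (hξ _ _ (hinv k)).isTrajectoryOn T)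
    (fun k => by rw [(hξ _ _ (hinv (k + 1))).apply_zero, hzs])
  rw [(hξ _ _ (hinv 0)).apply_zero, hz0] at htraj
  refine ⟨_, _, measurable_glue T fun k => hu _ _ (hinv k), htraj, fun t ht => ?_⟩
  have hk1 : (⌊t / T⌋₊ : ℝ) * T ≤ t := by
    rw [← le_div_iff₀ hT0]; exact Nat.floor_le (by positivity)
  have hk2 : t < (⌊t / T⌋₊ : ℝ) * T + T := by
    have := Nat.lt_floor_add_one (t / T)
    rw [div_lt_iff₀ hT0] at this; linarith
  have := hb _ _ (hinv ⌊t / T⌋₊) (t - ⌊t / T⌋₊ * T) ⟨by linarith, by linarith⟩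
  rw [beta_beta hα hα' _ (by positivity) (by linarith), add_sub_cancel] at this
  exact NNReal.coe_le_coe.2 this.le

end Construction

end ViscosityCBF

end

theorem theorem2 {n m : ℕ} (U : Set (EuclideanSpace ℝ (Fin m)))
    (hU : IsCompact U) (hU' : U.Nonempty)
    (f : EuclideanSpace ℝ (Fin n) × U → EuclideanSpace ℝ (Fin n))
    (hf : ∃ K : ℝ≥0, LipschitzWith K f)
    (α : ℝ≥0 → ℝ≥0) (hα : ViscosityCBF.IsClassK α) (hα' : LocallyLipschitz α)
    (h : EuclideanSpace ℝ (Fin n) → ℝ≥0) (hh : Continuous h) :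
    List.TFAE [
      ViscosityCBF.IsViscosityCBF f α (fun x => (h x : ℝ)),
      ViscosityCBF.IsViscositySolution
        (fun x r p => -min (ViscosityCBF.hamiltonian f α x r p) 0) h,
      ∀ (T : ℝ≥0) (x : EuclideanSpace ℝ (Fin n)), ViscosityCBF.cbvf f α h x T = h x,
      ViscosityCBF.ProvidesBarrierGuarantee f α (fun x => (h x : ℝ))] := by
  obtain ⟨K, hK⟩ := hf
  tfae_have 1 → 2 := ViscosityCBF.isViscositySolution_of_isViscosityCBF hh
  tfae_have 2 → 1 := ViscosityCBF.isViscosityCBF_of_isViscositySolution hh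
  tfae_have 1 → 4 :=
    ViscosityCBF.providesBarrierGuarantee_of_isViscosityCBF hU hU' hK hα hα' hh
  tfae_have 4 → 3 := ViscosityCBF.cbvf_eq_of_providesBarrierGuarantee hα hα'
  tfae_have 3 → 1 := ViscosityCBF.isViscosityCBF_of_cbvf_eq hU hK hα hα' hh
  tfae_finish
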